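/- Let $W:[0,1]^2\to[0,1]$ be a graphon (symmetric and measurable) that is $A_1$-Lipschitz: $|W(u_2,v_2)-W(u_1,v_1)|\le A_1(|u_2-u_1|+|v_2-v_1|)$. Let $T_W$ be the operator $(T_WX)(v)=\int_0^1W(u,v)X(u)\,du$ on real $L_2([0,1])$. Its eigenvalues $\lambda_i$, $i\in\mathbb Z\setminus\{0\}$, are counted with multiplicity and ordered as $1\ge\lambda_1\ge\lambda_2\ge\dots\ge 0\ge\dots\ge\lambda_{-2}\ge\lambda_{-1}\ge-1$, a finite list of positive or of negative eigenvalues being continued by zeros. Let $c>0$ and let $h$ be a real function, constant on $\{\lambda\in[-1,1]:|\lambda|<c\}$, with $|h(\lambda)-h(\lambda')|\le A_2|\lambda-\lambda'|$ and $|h(\lambda)|<1$ for $\lambda,\lambda'\in[-1,1]$. The graphon convolution with spectral response $h$ is $T_HX=\sum_\varphi h(\lambda_\varphi)\langle\varphi,X\rangle\varphi$, where $\varphi$ runs over an orthonormal basis of $L_2([0,1])$ of eigenfunctions of $T_W$ (including those with eigenvalue $0$) and $T_W\varphi=\lambda_\varphi\varphi$. Let $X:[0,1]\to\mathbb R$ be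 square-integrable and let $n\ge1$. Put $u_i=(i-1)/n$ for $1\le i\le n$ and let $I_1,\dots,I_n$ be the partition of $[0,1]$ into the intervals with endpoints $(i-1)/n$ and $i/n$. The deterministic $n$-node graph and signal are $[S_n]_{ij}=W(u_i,u_j)$ and $[x_n]_i=X(u_i)$. They induce the graphon $W_n$ equal to $[S_n]_{ij}$ on $I_i\times I_j$ and the graphon signal $X_n$ equal to $[x_n]_i$ on $I_i$. Let $\lambda_i^n$ be the eigenvalues of $T_{W_n}$, ordered as above, and let $T_{H_n}$ be the convolution with the same response $h$ for $W_n$. Put $Y=T_HX$ and $Y_n=T_{H_n}X_n$. Let $n_c$ be the number of elements of $\mathcal C=\{i\in\mathbb Z\setminus\{0\}:|\lambda_i^n|\ge c\}$ and $$\delta_c=\min_{i\in\mathcal C}\bigl(|\lambda_i-\lambda^n_{i+\mathrm{sgn}(i)}|,\ |\lambda_{i+\mathrm{sgn}(i)}-\lambda^n_i|,\ |\lambda_1-\lambda^n_{-1}|,\ |\lambda^n_1-\lambda_{-1}|\bigr).$$ Assume $\delta_c>0$ if $\mathcal C\ne\emptyset$, and read $n_c/\delta_c$ as $0$ if $\mathcal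 C=\emptyset$. If $X$ is $A_3$-Lipschitz, then $$\|Y-Y_n\|_{L_2}\le\sqrt{A_1}\Bigl(A_2+\frac{\pi n_c}{\delta_c}\Bigr)n^{-1/2}\|X\|_{L_2}+\frac{2A_3}{\sqrt3}\,n^{-1/2}.$$ If $X=X_n$ almost everywhere (whether or not $X$ is Lipschitz), then $$\|Y-Y_n\|_{L_2}\le\sqrt{A_1}\Bigl(A_2+\frac{\pi n_c}{\delta_c}\Bigr)n^{-1/2}\|X\|_{L_2}.$$ -/

import Mathlib

open MeasureTheory
open scoped unitInterval

/-- A graphon: a measurable symmetric function `[0,1]² → [0,1]`. -/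
structure Graphon where
  toFun : I → I → ℝ
  measurable' : Measurable (Function.uncurry toFun)
  symm' : ∀ u v, toFun u v = toFun v u
  mem_Icc' : ∀ u v, toFun u v ∈ Set.Icc (0 : ℝ) 1

/-- The space `L₂([0,1])` of (real) graphon signals. -/
abbrev SignalSpace : Type := Lp ℝ 2 (volume : Measure I)

namespace Graphon

theorem norm_le_one (W : Graphon) (u v : I) : ‖W.toFun u v‖ ≤ 1 := by
  rw [Real.norm_eq_abs, abs_of_nonneg (W.mem_Icc' u v).1]
  exact (W.mem_Icc' u v).2

theorem measurable_left (W : Graphon) (v : I) : Measurable (fun u => W.toFun u v) :=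
  W.measurable'.comp (measurable_id.prodMk measurable_const)

theorem integrable_signal (X : SignalSpace) : Integrable (X : I → ℝ) volume :=
  (Lp.memLp X).integrable (by norm_num)

theorem integrable_mul (W : Graphon) (X : SignalSpace) (v : I) :
    Integrable (fun u => W.toFun u v * X u) volume :=
  (integrable_signal X).bdd_mul (W.measurable_left v).aestronglyMeasurable
    (Filter.Eventually.of_forall fun u => W.norm_le_one u v)

theorem integral_norm_le (X : SignalSpace) : ∫ u, ‖X u‖ ≤ ‖X‖ := by
  rw [integral_norm_eq_lintegral_enorm (Lp.aestronglyMeasurable X), Lp.norm_def,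
    ← eLpNorm_one_eq_lintegral_enorm]
  exact ENNReal.toReal_mono (Lp.eLpNorm_ne_top X)
    (eLpNorm_le_eLpNorm_of_exponent_le (by norm_num) (Lp.aestronglyMeasurable X))

theorem norm_integral_le (W : Graphon) (X : SignalSpace) (v : I) :
    ‖∫ u, W.toFun u v * X u‖ ≤ ‖X‖ := by
  refine (norm_integral_le_integral_norm _).trans (le_trans ?_ (integral_norm_le X))
  refine integral_mono (W.integrable_mul X v).norm (integrable_signal X).norm fun u => ?_
  simp only [norm_mul]
  exact mul_le_of_le_one_left (norm_nonneg _) (W.norm_le_one u v)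

theorem memLp_integral (W : Graphon) (X : SignalSpace) :
    MemLp (fun v => ∫ u, W.toFun u v * X u) 2 (volume : Measure I) := by
  refine MemLp.of_bound ?_ ‖X‖ (Filter.Eventually.of_forall fun v => W.norm_integral_le X v)
  have h1 : StronglyMeasurable (Function.uncurry fun (v u : I) => W.toFun u v * X u) := by
    refine StronglyMeasurable.mul ?_ ((Lp.stronglyMeasurable X).comp_measurable measurable_snd)
    exact (W.measurable'.comp measurable_swap).stronglyMeasurable
  exact h1.integral_prod_right.aestronglyMeasurable

/-- The graphon shift operator `(T_W X)(v) = ∫ W(u,v) X(u) du` on `L₂([0,1])`. -/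
noncomputable def shift (W : Graphon) : SignalSpace →L[ℝ] SignalSpace :=
  LinearMap.mkContinuous
    { toFun := fun X => (W.memLp_integral X).toLp _
      map_add' := fun X Z => by
        rw [← MemLp.toLp_add]
        refine (MemLp.toLp_eq_toLp_iff _ _).2 (Filter.Eventually.of_forall fun v => ?_)
        simp only [Pi.add_apply]
        rw [← integral_add (W.integrable_mul X v) (W.integrable_mul Z v)]
        refine integral_congr_ae ?_
        filter_upwards [Lp.coeFn_add X Z] with u hu
        rw [hu, Pi.add_apply, mul_add]
      map_smul' := fun a X => by
        rw [RingHom.id_apply, ← MemLp.toLp_const_smul]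
        refine (MemLp.toLp_eq_toLp_iff _ _).2 (Filter.Eventually.of_forall fun v => ?_)
        simp only [Pi.smul_apply, smul_eq_mul]
        rw [← integral_const_mul]
        refine integral_congr_ae ?_
        filter_upwards [Lp.coeFn_smul a X] with u hu
        rw [hu, Pi.smul_apply, smul_eq_mul]
        ring }
    1 (fun X => by
      rw [one_mul]
      refine Lp.norm_le_of_ae_bound (norm_nonneg X) ?_ |>.trans ?_
      · filter_upwards [(W.memLp_integral X).coeFn_toLp] with v hv
        change ‖((W.memLp_integral X).toLp _ : I → ℝ) v‖ ≤ ‖X‖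
        rw [hv]
        exact W.norm_integral_le X v
      · simp [measureUnivNNReal])

end Graphon

/-! ### Deterministic graphs and signals, and the graphon objects they induce -/

/-- The sampling points `(i-1)/n`, `1 ≤ i ≤ n`; here indexed from `0`. -/
noncomputable def samplePoint (n : ℕ) (i : Fin n) : I :=
  ⟨(i : ℝ) / n, by positivity,
    div_le_one_of_le₀ (by exact_mod_cast i.is_lt.le) (by positivity)⟩

/-- The index of the cell of the partition of `[0,1]` into `n` intervals of length `1/n` that
contains `u`: the cells are `[i/n, (i+1)/n)` for `0 ≤ i < n`, the last one being closed. -/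
noncomputable def cell (n : ℕ) [NeZero n] (u : I) : Fin n :=
  ⟨min ⌊(n : ℝ) * u⌋₊ (n - 1), by have := NeZero.pos n; omega⟩

theorem measurable_cell (n : ℕ) [NeZero n] : Measurable (cell n) := by
  have h1 : Measurable fun u : I => ⌊(n : ℝ) * u⌋₊ :=
    Nat.measurable_floor.comp (measurable_const.mul measurable_subtype_coe)
  have h2 : Measurable fun u : I => min ⌊(n : ℝ) * u⌋₊ (n - 1) := h1.min measurable_const
  refine measurable_to_countable' fun i => ?_
  have h3 : cell n ⁻¹' {i} = (fun u : I => min ⌊(n : ℝ) * u⌋₊ (n - 1)) ⁻¹' {(i : ℕ)} := by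
    ext u
    simp [cell, Fin.ext_iff]
  rw [h3]
  exact h2 (measurableSet_singleton _)

namespace Graphon

/-- The adjacency matrix `[S_n]_{ij} = W(u_i, u_j)` of the deterministic graph on `n` nodes. -/
noncomputable def graphMatrix (W : Graphon) (n : ℕ) : Matrix (Fin n) (Fin n) ℝ :=
  fun i j => W.toFun (samplePoint n i) (samplePoint n j)

theorem measurable_induced (W : Graphon) (n : ℕ) [NeZero n] :
    Measurable (Function.uncurry fun u v : I => W.graphMatrix n (cell n u) (cell n v)) := by
  have h1 : ∀ f : Fin n → Fin n → ℝ,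
      Measurable (Function.uncurry fun u v : I => f (cell n u) (cell n v)) := fun f => by
    have h2 : Measurable (Function.uncurry f) := measurable_of_countable _
    exact h2.comp ((measurable_cell n).prodMap (measurable_cell n))
  exact h1 fun i j => W.graphMatrix n i j

/-- The graphon `W_n` induced by the deterministic graph: it takes the value `[S_n]_{ij}` on the
product of the `i`-th and the `j`-th cell. -/
noncomputable def induced (W : Graphon) (n : ℕ) [NeZero n] : Graphon where
  toFun u v := W.graphMatrix n (cell n u) (cell n v)
  measurable' := W.measurable_induced n
  symm' := fun u v => W.symm' (samplePoint n (cell n u)) (samplePoint n (cell n v))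
  mem_Icc' := fun u v => W.mem_Icc' (samplePoint n (cell n u)) (samplePoint n (cell n v))

end Graphon

/-- The deterministic graph signal `[x_n]_i = X(u_i)`. -/
noncomputable def graphSignal (X : I → ℝ) (n : ℕ) : Fin n → ℝ := fun i => X (samplePoint n i)

/-- The graphon signal `X_n` induced by `x_n`: it takes the value `[x_n]_i` on the `i`-th cell. -/
noncomputable def inducedSignal (X : I → ℝ) (n : ℕ) [NeZero n] : I → ℝ :=
  fun u => graphSignal X n (cell n u)

theorem memLp_inducedSignal (X : I → ℝ) (n : ℕ) [NeZero n] :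
    MemLp (inducedSignal X n) 2 (volume : Measure I) := by
  refine MemLp.of_bound
    ((measurable_of_countable (graphSignal X n)).comp (measurable_cell n)).aestronglyMeasurable
    (∑ i, ‖graphSignal X n i‖) (Filter.Eventually.of_forall fun u => ?_)
  exact Finset.single_le_sum (f := fun i => ‖graphSignal X n i‖) (fun i _ => norm_nonneg _)
    (Finset.mem_univ (cell n u))

/-! ### Spectral convolutions -/

/-- The `μ`-eigenspace of a bounded operator `T` on `L₂([0,1])`. -/
noncomputable abbrev eigSpace (T : SignalSpace →L[ℝ] SignalSpace) (μ : ℝ) :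
    Submodule ℝ SignalSpace :=
  Module.End.eigenspace (T : SignalSpace →ₗ[ℝ] SignalSpace) μ

instance eigSpace_hasOrthogonalProjection (T : SignalSpace →L[ℝ] SignalSpace) (μ : ℝ) :
    (eigSpace T μ).HasOrthogonalProjection := by
  have hcl : IsClosed (eigSpace T μ : Set SignalSpace) := by
    have he : (eigSpace T μ : Set SignalSpace) = {x | T x = μ • x} := by
      ext x
      simp [eigSpace]
    rw [he]
    exact isClosed_eq T.continuous (continuous_const_smul μ)
  have : CompleteSpace (eigSpace T μ) := hcl.completeSpace_coe
  infer_instance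

/-- The convolution with spectral response `h` relative to a self-adjoint compact operator `T`:
`∑ h(λ) ⟨φ, X⟩ φ` over an orthonormal basis of eigenfunctions `φ` of `T`, with the terms grouped by
eigenvalue, i.e. `∑_μ h(μ) P_μ X` where `P_μ` is the orthogonal projection onto the
`μ`-eigenspace. The eigenvalue `0` is included, so that `h(λ) = ∑ h_k λ^k` yields `∑ h_k T^k X`,
with `T^0` the identity. Only the countably many eigenvalues `μ` contribute, and the series
converges in `L₂` as soon as `h` is bounded on them. -/
noncomputable def specConv (h : ℝ → ℝ) (T : SignalSpace →L[ℝ] SignalSpace) (X : SignalSpace) :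
    SignalSpace :=
  ∑' μ : ℝ, h μ • (eigSpace T μ).starProjection X

/-- The `k`-th largest positive eigenvalue of `T` (`k ≥ 1`), counted with multiplicity: the largest
`t > 0` such that at least `k` eigenvalues are `≥ t`. It is `0` when `T` has fewer than `k` positive
eigenvalues (supremum of the empty set). -/
noncomputable def posEigenvalue (T : SignalSpace →L[ℝ] SignalSpace) (k : ℕ) : ℝ :=
  sSup {t : ℝ | 0 < t ∧
    (k : Cardinal) ≤ Module.rank ℝ (⨆ μ ∈ Set.Ici t, eigSpace T μ : Submodule ℝ SignalSpace)}

namespace Graphon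

/-- The eigenvalues `λ_i(W)`, `i ∈ ℤ ∖ {0}`, of `T_W` counted with multiplicity and ordered by sign
and decreasing absolute value, `λ_1 ≥ λ_2 ≥ … ≥ 0 ≥ … ≥ λ_{-2} ≥ λ_{-1}`; a finite list of positive
or of negative eigenvalues is continued by zeros. The value at `i = 0` is not used. -/
noncomputable def eigenvalue (W : Graphon) (i : ℤ) : ℝ :=
  if 0 < i then posEigenvalue W.shift i.natAbs else -posEigenvalue (-W.shift) i.natAbs

/-- The set of indices `i ∈ ℤ ∖ {0}` with `|λ_i(W)| ≥ c`. -/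
def band (W : Graphon) (c : ℝ) : Set ℤ := {i | i ≠ 0 ∧ c ≤ |W.eigenvalue i|}

/-- `δ_c`, for the graphons `W` and `W'` (`W'` in the role of `W_n`): the minimum over the indices
`i` with `|λ_i(W')| ≥ c` of the four distances. -/
noncomputable def eigengap (W W' : Graphon) (c : ℝ) : ℝ :=
  sInf {d : ℝ | ∃ i ∈ W'.band c,
    d = |W.eigenvalue i - W'.eigenvalue (i + i.sign)| ∨
    d = |W.eigenvalue (i + i.sign) - W'.eigenvalue i| ∨
    d = |W.eigenvalue 1 - W'.eigenvalue (-1)| ∨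
    d = |W'.eigenvalue 1 - W.eigenvalue (-1)|}

/-- `n_c`: the number of indices `i` with `|λ_i(W)| ≥ c`. -/
noncomputable def bandCard (W : Graphon) (c : ℝ) : ℕ := (W.band c).ncard

end Graphon

/-! Write `E = ‖T_W - T_{W_n}‖` and `δ = δ_c`. The proof separates sampling from spectral
perturbation.

Sampling: both kernels take values in `[0,1]`, so `(W - W_n)² ≤ |W - W_n|`, which is at most `A₁`
times the sum of the distances of `u` and `v` from the left ends of their cells. Such a distance has
mean at most `1/(2n)`, so the Hilbert–Schmidt norm gives `E ≤ √(A₁/n)`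
(`Graphon.norm_shift_sub_induced_le`).

Perturbation (`Graphon.norm_specConv_sub_le`): the two convolutions of `x` differ by at most `E (A₂
+ 2 n_c/δ) ‖x‖`, and `2 ≤ π`. If the band is nonempty and `E ≥ δ`, the trivial bound `2‖x‖`
suffices. Otherwise Weyl's inequality `|λ_i - λ_i^n| ≤ E` (`abs_posEigenvalue_sub_le`) fixes the
sign of each gap in `δ_c`, and monotonicity separates every band eigenvalue of one operator from `0`
and from the differently indexed eigenvalues of the other by `δ` (`gap_of_antitone`,
`Graphon.eigenvalue_separated`). On the eigenvalues of `T_{W_n}` the response equals `h 0` plus a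
finite sum of `β_i` times the indicator of `λ_i^n`, with `|β_i| ≤ 2`. Moving these indicators to
`λ_i` gives a function `g` with `|h - g| ≤ A₂ E` on the eigenvalues of `T_W`. Hence `h(T_W) -
h(T_{W_n}) = (h - g)(T_W) + ∑ β_i (P_i - P_i^n)`, where `‖P_i - P_i^n‖ ≤ E/δ` by a Davis–Kahan
argument (`norm_eigProj_sub_eigProj_le`).

The signal error is separate: `h(T_{W_n})` does not increase norms, and `‖X - X_n‖ ≤ A₃/n`. -/

/-! ### Spectral convolutions of compact self-adjoint operators -/

section Spectral

variable {T : SignalSpace →L[ℝ] SignalSpace}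

theorem mem_eigSpace {μ : ℝ} {x : SignalSpace} : x ∈ eigSpace T μ ↔ T x = μ • x := by
  simp [eigSpace]

theorem eigSpace_orthogonalFamily (hs : (T : SignalSpace →ₗ[ℝ] SignalSpace).IsSymmetric) :
    OrthogonalFamily ℝ (fun μ : ℝ => eigSpace T μ) fun μ => (eigSpace T μ).subtypeₗᵢ :=
  hs.orthogonalFamily_eigenspaces

theorem inner_eq_zero_of_mem_eigSpace (hs : (T : SignalSpace →ₗ[ℝ] SignalSpace).IsSymmetric)
    {μ ν : ℝ} (h : μ ≠ ν) {x y : SignalSpace} (hx : x ∈ eigSpace T μ) (hy : y ∈ eigSpace T ν) :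
    inner ℝ x y = 0 :=
  eigSpace_orthogonalFamily hs h ⟨x, hx⟩ ⟨y, hy⟩

theorem eigProj_of_mem_of_ne (hs : (T : SignalSpace →ₗ[ℝ] SignalSpace).IsSymmetric)
    {μ ν : ℝ} (h : μ ≠ ν) {x : SignalSpace} (hx : x ∈ eigSpace T μ) :
    (eigSpace T ν).starProjection x = 0 :=
  (Submodule.starProjection_apply_eq_zero_iff _).2 fun _ hy =>
    inner_eq_zero_of_mem_eigSpace hs h.symm hy hx

theorem eigProj_map (hs : (T : SignalSpace →ₗ[ℝ] SignalSpace).IsSymmetric) (μ : ℝ)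
    (x : SignalSpace) :
    (eigSpace T μ).starProjection (T x) = μ • (eigSpace T μ).starProjection x := by
  refine Submodule.eq_starProjection_of_mem_of_inner_eq_zero
    (Submodule.smul_mem _ _ (Submodule.starProjection_apply_mem _ _)) fun w hw => ?_
  have h1 : inner ℝ (T x) w = inner ℝ x (T w) := hs x w
  have h2 := Submodule.starProjection_inner_eq_zero x w hw
  rw [inner_sub_left] at h2 ⊢
  rw [h1, mem_eigSpace.1 hw, inner_smul_right, inner_smul_left]
  simp only [conj_trivial]
  rw [← mul_sub, h2, mul_zero]

theorem abs_le_norm_of_eigSpace_ne_bot {μ : ℝ} (h : eigSpace T μ ≠ ⊥) : |μ| ≤ ‖T‖ := by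
  obtain ⟨x, hx, hx0⟩ := Submodule.exists_mem_ne_zero_of_ne_bot h
  have h1 := T.le_opNorm x
  rw [mem_eigSpace.1 hx, norm_smul, Real.norm_eq_abs] at h1
  exact le_of_mul_le_mul_right h1 (norm_pos_iff.2 hx0)

theorem eigProj_eq_zero_of_eq_bot {μ : ℝ} (h : eigSpace T μ = ⊥) (x : SignalSpace) :
    (eigSpace T μ).starProjection x = 0 :=
  (Submodule.mem_bot ℝ).1 (h.le (Submodule.starProjection_apply_mem (eigSpace T μ) x))

theorem hasSum_eigProj (hs : (T : SignalSpace →ₗ[ℝ] SignalSpace).IsSymmetric)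
    (hc : IsCompactOperator T) (x : SignalSpace) :
    HasSum (fun μ : ℝ => (eigSpace T μ).starProjection x) x := by
  have hcl : ∀ μ, CompleteSpace (eigSpace T μ) := fun μ => by
    have hcl : IsClosed (eigSpace T μ : Set SignalSpace) := by
      have he : (eigSpace T μ : Set SignalSpace) = {x | T x = μ • x} := by
        ext x
        simp [eigSpace]
      rw [he]
      exact isClosed_eq T.continuous (continuous_const_smul μ)
    exact hcl.completeSpace_coe
  have hH : IsHilbertSum ℝ (fun μ : ℝ => eigSpace T μ) fun μ => (eigSpace T μ).subtypeₗᵢ := by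
    refine IsHilbertSum.mkInternal _ (eigSpace_orthogonalFamily hs) ?_
    rw [top_le_iff, ← Submodule.orthogonal_eq_bot_iff, Submodule.orthogonal_closure]
    exact ContinuousLinearMap.orthogonalComplement_iSup_eigenspaces_eq_bot hc hs
  have h1 := hH.hasSum_linearIsometryEquiv_symm (hH.linearIsometryEquiv x)
  rw [LinearIsometryEquiv.symm_apply_apply] at h1
  convert h1 using 1
  funext μ
  -- Projecting the Hilbert sum onto one eigenspace kills all other summands, which identifies the
  -- abstract component with the projection of `x`.
  have h2 := h1.mapL (eigSpace T μ).starProjection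
  have h3 := hasSum_single (f := fun ν : ℝ => (eigSpace T μ).starProjection
    ((eigSpace T ν).subtypeₗᵢ (hH.linearIsometryEquiv x ν))) μ fun ν hν =>
      eigProj_of_mem_of_ne hs hν (hH.linearIsometryEquiv x ν).2
  rw [h2.unique h3]
  exact Submodule.starProjection_eq_self_iff.2 (hH.linearIsometryEquiv x μ).2

/-- Parseval: pair the series with its sum `y`; orthogonality of the eigenspaces reduces `⟪y, f μ⟫`
to `‖f μ‖ ^ 2`. -/
theorem hasSum_norm_sq_of_hasSum (hs : (T : SignalSpace →ₗ[ℝ] SignalSpace).IsSymmetric)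
    {f : ℝ → SignalSpace} (hf : ∀ μ, f μ ∈ eigSpace T μ) {y : SignalSpace} (hy : HasSum f y) :
    HasSum (fun μ => ‖f μ‖ ^ 2) (‖y‖ ^ 2) := by
  have h1 := hy.mapL (innerSL ℝ y)
  simp only [innerSL_apply_apply, real_inner_self_eq_norm_sq] at h1
  refine h1.congr_fun ?_
  intro μ
  have h2 := hy.mapL (innerSL ℝ (f μ))
  have h3 := hasSum_single (f := fun ν : ℝ => innerSL ℝ (f μ) (f ν)) μ fun ν hν =>
      inner_eq_zero_of_mem_eigSpace hs hν.symm (hf μ) (hf ν)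
  have h4 := h2.unique h3
  simp only [innerSL_apply_apply, real_inner_self_eq_norm_sq] at h4
  rw [real_inner_comm, h4]

theorem summable_specConv (hs : (T : SignalSpace →ₗ[ℝ] SignalSpace).IsSymmetric)
    (hc : IsCompactOperator T) {g : ℝ → ℝ} {B : ℝ}
    (hg : ∀ μ, eigSpace T μ ≠ ⊥ → |g μ| ≤ B) (x : SignalSpace) :
    Summable fun μ : ℝ => g μ • (eigSpace T μ).starProjection x := by
  have h1 := hasSum_norm_sq_of_hasSum hs
    (fun μ => Submodule.starProjection_apply_mem _ x) (hasSum_eigProj hs hc x)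
  have h2 := (eigSpace_orthogonalFamily hs).summable_iff_norm_sq_summable
    (fun μ => g μ • (eigSpace T μ).orthogonalProjectionOnto x)
  refine h2.2 (Summable.of_nonneg_of_le (fun _ => sq_nonneg _) (fun μ => ?_)
    (h1.summable.mul_left (B ^ 2)))
  have hnorm : ‖(eigSpace T μ).orthogonalProjectionOnto x‖ = ‖(eigSpace T μ).starProjection x‖ :=
    rfl
  rw [norm_smul, mul_pow, Real.norm_eq_abs, hnorm]
  by_cases hμ : eigSpace T μ = ⊥
  · rw [eigProj_eq_zero_of_eq_bot hμ]
    simp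
  · gcongr
    exact hg μ hμ

theorem norm_specConv_le (hs : (T : SignalSpace →ₗ[ℝ] SignalSpace).IsSymmetric)
    (hc : IsCompactOperator T) {g : ℝ → ℝ} {B : ℝ} (hB : 0 ≤ B)
    (hg : ∀ μ, eigSpace T μ ≠ ⊥ → |g μ| ≤ B) (x : SignalSpace) :
    ‖specConv g T x‖ ≤ B * ‖x‖ := by
  have h1 := hasSum_norm_sq_of_hasSum hs
    (fun μ => Submodule.starProjection_apply_mem _ x) (hasSum_eigProj hs hc x)
  have h2 := hasSum_norm_sq_of_hasSum hs
    (fun μ => Submodule.smul_mem _ (g μ) (Submodule.starProjection_apply_mem (eigSpace T μ) x))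
    (summable_specConv hs hc hg x).hasSum
  have h3 : ‖specConv g T x‖ ^ 2 ≤ B ^ 2 * ‖x‖ ^ 2 := by
    refine hasSum_le (fun μ => ?_) h2 (h1.mul_left (B ^ 2))
    rw [norm_smul, mul_pow, Real.norm_eq_abs]
    by_cases hμ : eigSpace T μ = ⊥
    · rw [eigProj_eq_zero_of_eq_bot hμ]
      simp
    · gcongr
      exact hg μ hμ
  rw [← mul_pow] at h3
  exact le_of_sq_le_sq h3 (by positivity)

theorem specConv_congr {g g' : ℝ → ℝ} (h : ∀ μ, eigSpace T μ ≠ ⊥ → g μ = g' μ)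
    (x : SignalSpace) : specConv g T x = specConv g' T x := by
  refine tsum_congr fun μ => ?_
  by_cases hμ : eigSpace T μ = ⊥
  · rw [eigProj_eq_zero_of_eq_bot hμ, smul_zero, smul_zero]
  · rw [h μ hμ]

theorem specConv_sub_response (hs : (T : SignalSpace →ₗ[ℝ] SignalSpace).IsSymmetric)
    (hc : IsCompactOperator T) {g g' : ℝ → ℝ} {B B' : ℝ}
    (hg : ∀ μ, eigSpace T μ ≠ ⊥ → |g μ| ≤ B) (hg' : ∀ μ, eigSpace T μ ≠ ⊥ → |g' μ| ≤ B')
    (x : SignalSpace) :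
    specConv (fun μ => g μ - g' μ) T x = specConv g T x - specConv g' T x := by
  unfold specConv
  rw [← (summable_specConv hs hc hg x).tsum_sub (summable_specConv hs hc hg' x)]
  exact tsum_congr fun μ => sub_smul _ _ _

theorem specConv_sub (hs : (T : SignalSpace →ₗ[ℝ] SignalSpace).IsSymmetric)
    (hc : IsCompactOperator T) {g : ℝ → ℝ} {B : ℝ}
    (hg : ∀ μ, eigSpace T μ ≠ ⊥ → |g μ| ≤ B) (x y : SignalSpace) :
    specConv g T (x - y) = specConv g T x - specConv g T y := by
  unfold specConv
  rw [← (summable_specConv hs hc hg x).tsum_sub (summable_specConv hs hc hg y)]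
  exact tsum_congr fun μ => by rw [map_sub, smul_sub]

/-- A response that is constant off a finite set gives a finite combination of projections. -/
theorem specConv_const_add_sum (hs : (T : SignalSpace →ₗ[ℝ] SignalSpace).IsSymmetric)
    (hc : IsCompactOperator T) {ι : Type*} (S : Finset ι) (a b : ι → ℝ) (h₀ : ℝ)
    (x : SignalSpace) :
    specConv (fun μ => h₀ + ∑ i ∈ S, if μ = a i then b i else 0) T x =
      h₀ • x + ∑ i ∈ S, b i • (eigSpace T (a i)).starProjection x := by
  refine HasSum.tsum_eq ?_
  simp only [add_smul, Finset.sum_smul]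
  refine ((hasSum_eigProj hs hc x).const_smul h₀).add (hasSum_sum fun i _ => ?_)
  have h1 := hasSum_single (f := fun μ : ℝ =>
    (if μ = a i then b i else 0) • (eigSpace T μ).starProjection x) (a i)
    fun μ hμ => by rw [if_neg hμ, zero_smul]
  simpa using h1

/-- The part of `x` off the `a`-eigenspace is controlled by `(T - b) x` if `b` is at distance at
least `δ` from all other eigenvalues. -/
theorem norm_sub_eigProj_le (hs : (T : SignalSpace →ₗ[ℝ] SignalSpace).IsSymmetric)
    (hc : IsCompactOperator T) {a b δ : ℝ} (hδ : 0 < δ)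
    (hsep : ∀ μ, eigSpace T μ ≠ ⊥ → μ ≠ a → δ ≤ |μ - b|) (x : SignalSpace) :
    δ * ‖x - (eigSpace T a).starProjection x‖ ≤ ‖T x - b • x‖ := by
  -- The reduced resolvent: bounded by `δ⁻¹` on the eigenvalues, and inverse to `T - b` off the
  -- `a`-eigenspace.
  set g : ℝ → ℝ := fun μ => if μ = a then 0 else (μ - b)⁻¹ with hg
  have hgB : ∀ μ, eigSpace T μ ≠ ⊥ → |g μ| ≤ δ⁻¹ := fun μ hμ => by
    by_cases h : μ = a
    · simp [hg, h, hδ.le]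
    · simp only [hg, if_neg h, abs_inv]
      exact inv_anti₀ hδ (hsep μ hμ h)
  have h1 : specConv g T (T x - b • x) = x - (eigSpace T a).starProjection x := by
    refine HasSum.tsum_eq ?_
    have h2 := hasSum_single (f := fun μ : ℝ =>
      (if μ = a then (1 : ℝ) else 0) • (eigSpace T μ).starProjection x) a
      fun μ hμ => by rw [if_neg hμ, zero_smul]
    rw [if_pos rfl, one_smul] at h2
    convert (hasSum_eigProj hs hc x).sub h2 using 1
    funext μ
    rw [map_sub, map_smul, eigProj_map hs, ← sub_smul, smul_smul]
    by_cases h : μ = a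
    · simp [hg, h]
    · by_cases hμ : eigSpace T μ = ⊥
      · simp [eigProj_eq_zero_of_eq_bot hμ]
      · have : μ - b ≠ 0 := fun h0 => by
          have := hsep μ hμ h
          rw [h0, abs_zero] at this
          linarith
        simp [hg, h, this]
  have h3 := norm_specConv_le hs hc (inv_nonneg.2 hδ.le) hgB (T x - b • x)
  rw [h1] at h3
  calc δ * ‖x - (eigSpace T a).starProjection x‖ ≤ δ * (δ⁻¹ * ‖T x - b • x‖) := by gcongr
    _ = ‖T x - b • x‖ := by rw [← mul_assoc, mul_inv_cancel₀ hδ.ne', one_mul]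

end Spectral

/-- Two orthogonal projections are as close as their ranges are. -/
theorem norm_starProjection_sub_le {H : Type*} [NormedAddCommGroup H] [InnerProductSpace ℝ H]
    (K L : Submodule ℝ H) [K.HasOrthogonalProjection] [L.HasOrthogonalProjection] {s : ℝ}
    (hs : 0 ≤ s) (hKL : ∀ x ∈ K, ‖x - L.starProjection x‖ ≤ s * ‖x‖)
    (hLK : ∀ x ∈ L, ‖x - K.starProjection x‖ ≤ s * ‖x‖) (x : H) :
    ‖K.starProjection x - L.starProjection x‖ ≤ s * ‖x‖ := by
  set y := L.starProjection x with hy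
  set z := x - y with hz
  have hyL : y ∈ L := Submodule.starProjection_apply_mem _ _
  have hzL : z ∈ Lᗮ := Submodule.sub_starProjection_mem_orthogonal x
  have h1 : ‖K.starProjection z‖ ≤ s * ‖z‖ := by
    set w := K.starProjection z with hw
    have hwK : w ∈ K := Submodule.starProjection_apply_mem _ _
    -- Since `z` is orthogonal to `L`, only the part of `w` outside `L` is seen; this transfers
    -- `hKL` to `z` by duality.
    have h2 : ‖w‖ ^ 2 = inner ℝ (w - L.starProjection w) z := by
      rw [inner_sub_left, Submodule.inner_right_of_mem_orthogonal
        (Submodule.starProjection_apply_mem L w) hzL, sub_zero, ← real_inner_self_eq_norm_sq]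
      have := Submodule.starProjection_inner_eq_zero z w hwK
      rw [inner_sub_left, sub_eq_zero] at this
      rw [← this, real_inner_comm]
    have h3 : ‖w‖ * ‖w‖ ≤ (s * ‖z‖) * ‖w‖ := by
      rw [← pow_two, h2]
      calc _ ≤ ‖w - L.starProjection w‖ * ‖z‖ := real_inner_le_norm _ _
        _ ≤ (s * ‖w‖) * ‖z‖ := by gcongr; exact hKL w hwK
        _ = _ := by ring
    by_cases h0 : ‖w‖ = 0
    · rw [h0]; positivity
    · exact le_of_mul_le_mul_right h3 (lt_of_le_of_ne (norm_nonneg _) (Ne.symm h0))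
  have h4 := hLK y hyL
  -- The two terms lie in `K` and `Kᗮ`, so Pythagoras, used here and for `x = y + z`, gives the
  -- constant `s` instead of `2 * s`.
  have h5 : K.starProjection x - y = K.starProjection z - (y - K.starProjection y) := by
    rw [hz, map_sub]; abel
  have h6 : inner ℝ (K.starProjection z) (y - K.starProjection y) = 0 :=
    Submodule.inner_right_of_mem_orthogonal (Submodule.starProjection_apply_mem K z)
      (Submodule.sub_starProjection_mem_orthogonal y)
  have h7 : inner ℝ y z = 0 := Submodule.inner_right_of_mem_orthogonal hyL hzL
  have h8 : ‖x‖ ^ 2 = ‖y‖ ^ 2 + ‖z‖ ^ 2 := by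
    have : x = y + z := by rw [hz]; abel
    rw [this, norm_add_sq_real, h7]; ring
  have h9 : ‖K.starProjection x - y‖ ^ 2 ≤ (s * ‖x‖) ^ 2 := by
    rw [h5, norm_sub_sq_real, h6, mul_pow, h8]
    have := pow_le_pow_left₀ (norm_nonneg _) h1 2
    have := pow_le_pow_left₀ (norm_nonneg _) h4 2
    nlinarith
  exact le_of_sq_le_sq h9 (by positivity)

/-! ### Positive eigenvalues counted with multiplicity -/

section PosEigenvalue

variable {T T' : SignalSpace →L[ℝ] SignalSpace}

/-- `T` is a norm limit of operators of finite rank. -/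
def IsFiniteRankLimit (T : SignalSpace →L[ℝ] SignalSpace) : Prop :=
  ∀ ε : ℝ, 0 < ε → ∃ F : SignalSpace →L[ℝ] SignalSpace,
    FiniteDimensional ℝ (LinearMap.range (F : SignalSpace →ₗ[ℝ] SignalSpace)) ∧ ‖T - F‖ < ε

theorem isCompactOperator_of_finiteDimensional_range {F : SignalSpace →L[ℝ] SignalSpace}
    (hF : FiniteDimensional ℝ (LinearMap.range (F : SignalSpace →ₗ[ℝ] SignalSpace))) :
    IsCompactOperator F := by
  have := FiniteDimensional.proper ℝ (LinearMap.range (F : SignalSpace →ₗ[ℝ] SignalSpace))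
  have h1 : IsCompactOperator (F.codRestrict (LinearMap.range (F : SignalSpace →ₗ[ℝ] SignalSpace))
      fun x => LinearMap.mem_range_self (F : SignalSpace →ₗ[ℝ] SignalSpace) x) :=
    isCompactOperator_of_locallyCompactSpace_dom _
  exact h1.clm_comp (LinearMap.range (F : SignalSpace →ₗ[ℝ] SignalSpace)).subtypeL

theorem IsFiniteRankLimit.isCompactOperator (hT : IsFiniteRankLimit T) : IsCompactOperator T := by
  have h1 : T ∈ closure {F : SignalSpace →L[ℝ] SignalSpace | IsCompactOperator F} := by
    rw [Metric.mem_closure_iff]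
    intro ε hε
    obtain ⟨F, hF, hlt⟩ := hT ε hε
    exact ⟨F, isCompactOperator_of_finiteDimensional_range hF, by rwa [dist_eq_norm]⟩
  rwa [isClosed_setOfPred_isCompactOperator.closure_eq] at h1

theorem IsFiniteRankLimit.neg (hT : IsFiniteRankLimit T) : IsFiniteRankLimit (-T) := by
  intro ε hε
  obtain ⟨F, hF, hlt⟩ := hT ε hε
  refine ⟨-F, ?_, ?_⟩
  · have : LinearMap.range ((-F : SignalSpace →L[ℝ] SignalSpace) : SignalSpace →ₗ[ℝ] SignalSpace) =
        LinearMap.range (F : SignalSpace →ₗ[ℝ] SignalSpace) := by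
      rw [ContinuousLinearMap.toLinearMap_neg, LinearMap.range_neg]
    rwa [this]
  · rwa [neg_sub_neg, norm_sub_rev]

/-- The sum of the eigenspaces of the eigenvalues `≥ t`. -/
noncomputable abbrev upperEigSpace (T : SignalSpace →L[ℝ] SignalSpace) (t : ℝ) :
    Submodule ℝ SignalSpace :=
  ⨆ μ ∈ Set.Ici t, eigSpace T μ

theorem eigSpace_le_upperEigSpace {μ t : ℝ} (h : t ≤ μ) : eigSpace T μ ≤ upperEigSpace T t :=
  le_iSup₂_of_le (f := fun μ (_ : μ ∈ Set.Ici t) => eigSpace T μ) μ h le_rfl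

theorem upperEigSpace_anti {s t : ℝ} (h : s ≤ t) : upperEigSpace T t ≤ upperEigSpace T s :=
  iSup₂_le fun _ hμ => eigSpace_le_upperEigSpace (h.trans hμ)

theorem eigProj_eq_zero_of_mem_upperEigSpace
    (hs : (T : SignalSpace →ₗ[ℝ] SignalSpace).IsSymmetric) {μ t : ℝ} (h : μ < t)
    {x : SignalSpace} (hx : x ∈ upperEigSpace T t) : (eigSpace T μ).starProjection x = 0 := by
  have h1 : upperEigSpace T t ≤ (eigSpace T μ)ᗮ :=
    iSup₂_le fun ν hν y hy z hz =>
      inner_eq_zero_of_mem_eigSpace hs (h.trans_le hν).ne hz hy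
  exact (Submodule.starProjection_apply_eq_zero_iff _).2 (h1 hx)

theorem hasSum_mul_norm_eigProj_sq (hs : (T : SignalSpace →ₗ[ℝ] SignalSpace).IsSymmetric)
    (hc : IsCompactOperator T) (x : SignalSpace) :
    HasSum (fun μ : ℝ => μ * ‖(eigSpace T μ).starProjection x‖ ^ 2) (inner ℝ (T x) x) := by
  refine ((hasSum_eigProj hs hc x).mapL (innerSL ℝ (T x))).congr_fun fun μ => ?_
  have hm := Submodule.starProjection_apply_mem (eigSpace T μ) x
  have h1 := Submodule.starProjection_inner_eq_zero x _ hm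
  rw [inner_sub_left, sub_eq_zero, real_inner_self_eq_norm_sq] at h1
  have h2 : inner ℝ (T x) ((eigSpace T μ).starProjection x) =
    inner ℝ x (T ((eigSpace T μ).starProjection x)) := hs x _
  rw [innerSL_apply_apply, h2, mem_eigSpace.1 hm, inner_smul_right, h1]

theorem hasSum_norm_eigProj_sq (hs : (T : SignalSpace →ₗ[ℝ] SignalSpace).IsSymmetric)
    (hc : IsCompactOperator T) (x : SignalSpace) :
    HasSum (fun μ : ℝ => ‖(eigSpace T μ).starProjection x‖ ^ 2) (‖x‖ ^ 2) :=
  hasSum_norm_sq_of_hasSum hs (fun _ => Submodule.starProjection_apply_mem _ x)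
    (hasSum_eigProj hs hc x)

/-- With its companion below, this is all that is needed of the min-max principle: the quadratic
form is compared with `t ‖x‖ ^ 2` term by term in the spectral expansion. -/
theorem le_inner_of_mem_upperEigSpace (hs : (T : SignalSpace →ₗ[ℝ] SignalSpace).IsSymmetric)
    (hc : IsCompactOperator T) {t : ℝ} {x : SignalSpace} (hx : x ∈ upperEigSpace T t) :
    t * ‖x‖ ^ 2 ≤ inner ℝ (T x) x := by
  refine hasSum_le (fun μ => ?_) ((hasSum_norm_eigProj_sq hs hc x).mul_left t)
    (hasSum_mul_norm_eigProj_sq hs hc x)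
  rcases lt_or_ge μ t with h | h
  · rw [eigProj_eq_zero_of_mem_upperEigSpace hs h hx]
    simp
  · gcongr

theorem inner_le_of_mem_orthogonal_upperEigSpace
    (hs : (T : SignalSpace →ₗ[ℝ] SignalSpace).IsSymmetric)
    (hc : IsCompactOperator T) {t : ℝ} {x : SignalSpace} (hx : x ∈ (upperEigSpace T t)ᗮ) :
    inner ℝ (T x) x ≤ t * ‖x‖ ^ 2 := by
  refine hasSum_le (fun μ => ?_) (hasSum_mul_norm_eigProj_sq hs hc x)
    ((hasSum_norm_eigProj_sq hs hc x).mul_left t)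
  rcases le_or_gt t μ with h | h
  · rw [(Submodule.starProjection_apply_eq_zero_iff _).2
      (Submodule.orthogonal_le (eigSpace_le_upperEigSpace h) hx)]
    simp
  · gcongr

/-- A finite-rank `F` with `‖T - F‖ < t` is injective on this space: where `F` vanishes, the
quadratic form of `T` is at most `‖T - F‖ ‖x‖ ^ 2`. -/
theorem finiteDimensional_upperEigSpace (hs : (T : SignalSpace →ₗ[ℝ] SignalSpace).IsSymmetric)
    (hT : IsFiniteRankLimit T) {t : ℝ} (ht : 0 < t) :
    FiniteDimensional ℝ (upperEigSpace T t) := by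
  obtain ⟨F, hF, hlt⟩ := hT t ht
  let G : upperEigSpace T t →ₗ[ℝ] LinearMap.range (F : SignalSpace →ₗ[ℝ] SignalSpace) :=
    (F : SignalSpace →ₗ[ℝ] SignalSpace).rangeRestrict ∘ₗ (upperEigSpace T t).subtype
  refine FiniteDimensional.of_injective G ((injective_iff_map_eq_zero G).2 fun x hx => ?_)
  have h0 : F (x : SignalSpace) = 0 := congrArg Subtype.val hx
  by_contra hne
  have hpos : 0 < ‖(x : SignalSpace)‖ := norm_pos_iff.2 fun h => hne (Subtype.ext h)
  have h1 := le_inner_of_mem_upperEigSpace hs hT.isCompactOperator x.2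
  have h2 : ‖T x‖ ≤ ‖T - F‖ * ‖(x : SignalSpace)‖ := by
    have := (T - F).le_opNorm x
    rwa [sub_apply, h0, sub_zero] at this
  have h3 := real_inner_le_norm (T x) (x : SignalSpace)
  have h4 : ‖T - F‖ * ‖(x : SignalSpace)‖ ^ 2 < t * ‖(x : SignalSpace)‖ ^ 2 := by gcongr
  have h5 : ‖T x‖ * ‖(x : SignalSpace)‖ ≤ ‖T - F‖ * ‖(x : SignalSpace)‖ * ‖(x : SignalSpace)‖ := by
    gcongr
  nlinarith

/-- The levels `t > 0` with at least `k` eigenvalues `≥ t`. -/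
def eigLevels (T : SignalSpace →L[ℝ] SignalSpace) (k : ℕ) : Set ℝ :=
  {t : ℝ | 0 < t ∧ (k : Cardinal) ≤ Module.rank ℝ (upperEigSpace T t)}

theorem le_norm_of_mem_eigLevels {k : ℕ} (hk : 1 ≤ k) {t : ℝ} (ht : t ∈ eigLevels T k) :
    t ≤ ‖T‖ := by
  by_contra! h
  have h1 : upperEigSpace T t = ⊥ := by
    refine le_bot_iff.1 (iSup₂_le fun μ hμ => ?_)
    by_contra hne
    have := abs_le_norm_of_eigSpace_ne_bot (T := T) (μ := μ) fun h0 => hne h0.le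
    exact absurd ((le_abs_self μ).trans this) (not_le.2 (h.trans_le hμ))
  have h2 := ht.2
  rw [h1, rank_bot] at h2
  have : k = 0 := by exact_mod_cast le_antisymm h2 zero_le
  omega

theorem bddAbove_eigLevels {k : ℕ} (hk : 1 ≤ k) : BddAbove (eigLevels T k) :=
  ⟨‖T‖, fun _ ht => le_norm_of_mem_eigLevels hk ht⟩

theorem posEigenvalue_nonneg (k : ℕ) : 0 ≤ posEigenvalue T k :=
  Real.sSup_nonneg fun _ ht => ht.1.le

theorem posEigenvalue_anti {j k : ℕ} (hj : 1 ≤ j) (hjk : j ≤ k) :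
    posEigenvalue T k ≤ posEigenvalue T j := by
  refine Real.sSup_le (fun t ht => le_csSup (bddAbove_eigLevels hj) ⟨ht.1, le_trans ?_ ht.2⟩)
    (posEigenvalue_nonneg j)
  exact_mod_cast hjk

theorem mem_eigLevels_iff (hs : (T : SignalSpace →ₗ[ℝ] SignalSpace).IsSymmetric)
    (hT : IsFiniteRankLimit T) {k : ℕ} {t : ℝ} (ht : 0 < t) :
    t ∈ eigLevels T k ↔ k ≤ Module.finrank ℝ (upperEigSpace T t) := by
  have := finiteDimensional_upperEigSpace hs hT ht
  have h1 : t ∈ eigLevels T k ↔ (k : Cardinal) ≤ Module.rank ℝ (upperEigSpace T t) :=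
    ⟨fun h => h.2, fun h => ⟨ht, h⟩⟩
  rw [h1, ← Module.finrank_eq_rank]
  exact Nat.cast_le

/-- Weyl's inequality, one-sided. -/
theorem posEigenvalue_le_add (hs : (T : SignalSpace →ₗ[ℝ] SignalSpace).IsSymmetric)
    (hT : IsFiniteRankLimit T) (hs' : (T' : SignalSpace →ₗ[ℝ] SignalSpace).IsSymmetric)
    (hT' : IsFiniteRankLimit T') {k : ℕ} (hk : 1 ≤ k) :
    posEigenvalue T k ≤ posEigenvalue T' k + ‖T - T'‖ := by
  refine Real.sSup_le (fun t ht => ?_) (add_nonneg (posEigenvalue_nonneg k) (norm_nonneg _))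
  rw [← sub_le_iff_le_add]
  refine le_of_forall_lt fun s hst => ?_
  rcases lt_or_ge s 0 with h0 | h0
  · exact h0.trans_le (posEigenvalue_nonneg k)
  -- It suffices that every positive `r < t - ‖T - T'‖` is a level of `T'`. If not, a dimension
  -- count yields `x ≠ 0` in `upperEigSpace T t` orthogonal to `upperEigSpace T' r`, and the two
  -- quadratic form bounds contradict each other.
  obtain ⟨r, hsr, hrt⟩ := exists_between hst
  have hr : 0 < r := h0.trans_lt hsr
  refine hsr.trans_le (le_csSup (bddAbove_eigLevels hk) ?_)
  change r ∈ eigLevels T' k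
  rw [mem_eigLevels_iff hs' hT' hr]
  by_contra! hlt
  have hk' := (mem_eigLevels_iff hs hT ht.1).1 ht
  have := finiteDimensional_upperEigSpace hs hT ht.1
  have := finiteDimensional_upperEigSpace hs' hT' hr
  let G : upperEigSpace T t →ₗ[ℝ] upperEigSpace T' r :=
    ((upperEigSpace T' r).orthogonalProjectionOnto : SignalSpace →ₗ[ℝ] upperEigSpace T' r) ∘ₗ
      (upperEigSpace T t).subtype
  have hker := LinearMap.ker_ne_bot_of_finrank_lt (f := G) (hlt.trans_le hk')
  obtain ⟨x, hx, hx0⟩ := Submodule.exists_mem_ne_zero_of_ne_bot hker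
  have hxo : (x : SignalSpace) ∈ (upperEigSpace T' r)ᗮ :=
    Submodule.orthogonalProjectionOnto_eq_zero_iff.1 (LinearMap.mem_ker.1 hx)
  have hpos : 0 < ‖(x : SignalSpace)‖ := norm_pos_iff.2 fun h => hx0 (Subtype.ext h)
  have h1 := le_inner_of_mem_upperEigSpace hs hT.isCompactOperator x.2
  have h2 := inner_le_of_mem_orthogonal_upperEigSpace hs' hT'.isCompactOperator hxo
  have h3 := real_inner_le_norm ((T - T') (x : SignalSpace)) (x : SignalSpace)
  rw [sub_apply, inner_sub_left] at h3
  have h4 : ‖T x - T' x‖ * ‖(x : SignalSpace)‖ ≤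
      ‖T - T'‖ * ‖(x : SignalSpace)‖ * ‖(x : SignalSpace)‖ := by
    gcongr
    exact (T - T').le_opNorm x
  have h5 : (r + ‖T - T'‖) * ‖(x : SignalSpace)‖ ^ 2 < t * ‖(x : SignalSpace)‖ ^ 2 := by
    gcongr
    linarith
  nlinarith

theorem abs_posEigenvalue_sub_le (hs : (T : SignalSpace →ₗ[ℝ] SignalSpace).IsSymmetric)
    (hT : IsFiniteRankLimit T) (hs' : (T' : SignalSpace →ₗ[ℝ] SignalSpace).IsSymmetric)
    (hT' : IsFiniteRankLimit T') {k : ℕ} (hk : 1 ≤ k) :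
    |posEigenvalue T k - posEigenvalue T' k| ≤ ‖T - T'‖ := by
  have h1 := posEigenvalue_le_add hs hT hs' hT' hk
  have h2 := posEigenvalue_le_add hs' hT' hs hT hk
  rw [norm_sub_rev] at h2
  rw [abs_le]
  constructor <;> linarith

/-- Every positive eigenvalue occurs in the list `posEigenvalue T 1 ≥ posEigenvalue T 2 ≥ …`. -/
theorem exists_posEigenvalue_eq (hs : (T : SignalSpace →ₗ[ℝ] SignalSpace).IsSymmetric)
    (hT : IsFiniteRankLimit T) {μ : ℝ} (hμ : 0 < μ) (hne : eigSpace T μ ≠ ⊥) :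
    ∃ k : ℕ, 1 ≤ k ∧ posEigenvalue T k = μ := by
  have hfin := finiteDimensional_upperEigSpace hs hT hμ
  have hle : eigSpace T μ ≤ upperEigSpace T μ := eigSpace_le_upperEigSpace le_rfl
  have hk : 1 ≤ Module.finrank ℝ (upperEigSpace T μ) := by
    rw [Submodule.one_le_finrank_iff]
    exact fun h => hne (le_bot_iff.1 (h ▸ hle))
  -- The index is the number of eigenvalues `≥ μ`. A level `t > μ` with as many eigenvalues would
  -- put the eigenvectors of `μ` into a space orthogonal to them.
  refine ⟨_, hk, le_antisymm ?_ (le_csSup (bddAbove_eigLevels hk)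
    ((mem_eigLevels_iff hs hT hμ).2 le_rfl))⟩
  refine Real.sSup_le (fun t ht => ?_) hμ.le
  by_contra! hlt
  have h1 := (mem_eigLevels_iff hs hT ht.1).1 ht
  have h2 : upperEigSpace T t = upperEigSpace T μ :=
    Submodule.eq_of_le_of_finrank_le (upperEigSpace_anti hlt.le) h1
  obtain ⟨x, hx, hx0⟩ := Submodule.exists_mem_ne_zero_of_ne_bot hne
  have h3 := eigProj_eq_zero_of_mem_upperEigSpace hs hlt (h2 ▸ hle hx)
  rw [Submodule.starProjection_eq_self_iff.2 hx] at h3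
  exact hx0 h3

/-- Only finitely many positive eigenvalues, counted with multiplicity, are `≥ c > 0`. -/
theorem exists_le_of_le_posEigenvalue (hs : (T : SignalSpace →ₗ[ℝ] SignalSpace).IsSymmetric)
    (hT : IsFiniteRankLimit T) {c : ℝ} (hc : 0 < c) :
    ∃ N : ℕ, ∀ k, c ≤ posEigenvalue T k → k ≤ N := by
  -- Halving `c` leaves room to pick an actual level above `c / 2` without showing that the supremum
  -- is attained.
  refine ⟨Module.finrank ℝ (upperEigSpace T (c / 2)), fun k hk => ?_⟩
  have h1 : c / 2 < sSup (eigLevels T k) := (half_lt_self hc).trans_le hk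
  have h2 : (eigLevels T k).Nonempty := by
    by_contra h
    rw [Set.not_nonempty_iff_eq_empty.1 h, Real.sSup_empty] at h1
    linarith
  obtain ⟨t, ht, hlt⟩ := exists_lt_of_lt_csSup h2 h1
  have := finiteDimensional_upperEigSpace hs hT (half_pos hc)
  exact ((mem_eigLevels_iff hs hT ht.1).1 ht).trans
    (Submodule.finrank_mono (upperEigSpace_anti hlt.le))

end PosEigenvalue

/-! ### Graphon shift operators and sampling -/

namespace Graphon

theorem shift_coeFn (W : Graphon) (X : SignalSpace) :
    (W.shift X : I → ℝ) =ᵐ[volume] fun v => ∫ u, W.toFun u v * X u :=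
  (W.memLp_integral X).coeFn_toLp

theorem norm_shift_le_one (W : Graphon) : ‖W.shift‖ ≤ 1 :=
  LinearMap.mkContinuous_norm_le _ zero_le_one _

theorem shift_isSymmetric (W : Graphon) :
    (W.shift : SignalSpace →ₗ[ℝ] SignalSpace).IsSymmetric := by
  intro X Y
  change inner ℝ (W.shift X) Y = inner ℝ X (W.shift Y)
  rw [L2.inner_def, L2.inner_def]
  have h1 : ∫ v, inner ℝ ((W.shift X : I → ℝ) v) ((Y : I → ℝ) v) =
      ∫ v, ∫ u, W.toFun u v * X u * Y v := by
    refine integral_congr_ae ?_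
    filter_upwards [W.shift_coeFn X] with v hv
    rw [hv, integral_mul_const]
    simp [mul_comm]
  have h2 : ∫ u, inner ℝ ((X : I → ℝ) u) ((W.shift Y : I → ℝ) u) =
      ∫ u, ∫ v, W.toFun u v * X u * Y v := by
    refine integral_congr_ae ?_
    filter_upwards [W.shift_coeFn Y] with u hu
    rw [hu]
    simp only [RCLike.inner_apply, conj_trivial]
    rw [← integral_mul_const]
    refine integral_congr_ae (Filter.Eventually.of_forall fun v => ?_)
    simp only [W.symm' v u]
    ring
  rw [h1, h2]
  -- Fubini applies because a bounded kernel multiplies the integrable product `Y ⊗ X`.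
  refine integral_integral_swap (f := fun v u => W.toFun u v * X u * Y v) ?_
  have h3 : Integrable (fun p : I × I => Y p.1 * X p.2) (volume.prod volume) :=
    (integrable_signal Y).mul_prod (integrable_signal X)
  have h4 := h3.bdd_mul (c := 1) (f := fun p : I × I => W.toFun p.2 p.1)
    (W.measurable'.comp measurable_swap).aestronglyMeasurable
    (Filter.Eventually.of_forall fun p => W.norm_le_one p.2 p.1)
  refine h4.congr (Filter.Eventually.of_forall fun p => ?_)
  simp only [Function.uncurry]
  ring

/-- A shift operator bound by the Hilbert–Schmidt norm of the kernel. -/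
theorem norm_shift_sub_le (W W' : Graphon) (D : I → ℝ) (hD : Integrable D volume) (K : ℝ)
    (hK : ∫ u, D u ≤ K / 2)
    (h : ∀ u v, (W.toFun u v - W'.toFun u v) ^ 2 ≤ D u + D v) :
    ‖W.shift - W'.shift‖ ≤ √K := by
  refine ContinuousLinearMap.opNorm_le_bound _ (Real.sqrt_nonneg _) fun X => ?_
  have hb : ∀ v, MemLp (fun u => W.toFun u v - W'.toFun u v) 2 (volume : Measure I) := fun v =>
    MemLp.of_bound ((W.measurable_left v).sub (W'.measurable_left v)).aestronglyMeasurable 2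
      (Filter.Eventually.of_forall fun u => (norm_sub_le _ _).trans (by
        linarith [W.norm_le_one u v, W'.norm_le_one u v]))
  -- Cauchy–Schwarz in `u` for fixed `v`. Integrating `D u` here gives one `K / 2`; integrating `D
  -- v` below gives the other.
  have hpt : ∀ v, (∫ u, (W.toFun u v - W'.toFun u v) * X u) ^ 2 ≤ (K / 2 + D v) * ‖X‖ ^ 2 := by
    intro v
    have h1 : ∫ u, (W.toFun u v - W'.toFun u v) * X u = inner ℝ ((hb v).toLp _) X := by
      rw [L2.inner_def]
      refine integral_congr_ae ?_
      filter_upwards [(hb v).coeFn_toLp] with u hu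
      rw [hu]
      simp [mul_comm]
    have h2 : ‖(hb v).toLp _‖ ^ 2 ≤ K / 2 + D v := by
      rw [← real_inner_self_eq_norm_sq, L2.inner_def]
      have h3 : ∫ u, inner ℝ (((hb v).toLp _ : I → ℝ) u) (((hb v).toLp _ : I → ℝ) u) =
          ∫ u, (W.toFun u v - W'.toFun u v) ^ 2 := by
        refine integral_congr_ae ?_
        filter_upwards [(hb v).coeFn_toLp] with u hu
        rw [hu]
        simp [pow_two]
      rw [h3]
      calc ∫ u, (W.toFun u v - W'.toFun u v) ^ 2 ≤ ∫ u, (D u + D v) :=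
            integral_mono_of_nonneg (Filter.Eventually.of_forall fun u => sq_nonneg _)
              (hD.add (integrable_const _)) (Filter.Eventually.of_forall fun u => h u v)
        _ = (∫ u, D u) + D v := by
            rw [integral_add hD (integrable_const _)]
            simp
        _ ≤ K / 2 + D v := by gcongr
    rw [h1]
    calc (inner ℝ ((hb v).toLp _) X) ^ 2 ≤ (‖(hb v).toLp _‖ * ‖X‖) ^ 2 :=
          sq_le_sq' (neg_le_of_abs_le (abs_real_inner_le_norm _ _)) (real_inner_le_norm _ _)
      _ = ‖(hb v).toLp _‖ ^ 2 * ‖X‖ ^ 2 := mul_pow _ _ _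
      _ ≤ _ := by gcongr
  have hsq : ‖(W.shift - W'.shift) X‖ ^ 2 ≤ K * ‖X‖ ^ 2 := by
    rw [← real_inner_self_eq_norm_sq, L2.inner_def]
    have h3 : ∫ v, inner ℝ (((W.shift - W'.shift) X : I → ℝ) v)
        (((W.shift - W'.shift) X : I → ℝ) v) =
        ∫ v, (∫ u, (W.toFun u v - W'.toFun u v) * X u) ^ 2 := by
      refine integral_congr_ae ?_
      filter_upwards [W.shift_coeFn X, W'.shift_coeFn X, Lp.coeFn_sub (W.shift X) (W'.shift X)]
        with v h1 h2 h3
      have h4 : ((W.shift - W'.shift) X : I → ℝ) v =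
          ∫ u, (W.toFun u v - W'.toFun u v) * X u := by
        rw [sub_apply, h3, Pi.sub_apply, h1, h2,
          ← integral_sub (W.integrable_mul X v) (W'.integrable_mul X v)]
        simp only [sub_mul]
      rw [h4]
      simp [pow_two]
    rw [h3]
    calc ∫ v, (∫ u, (W.toFun u v - W'.toFun u v) * X u) ^ 2
        ≤ ∫ v, (K / 2 + D v) * ‖X‖ ^ 2 :=
          integral_mono_of_nonneg (Filter.Eventually.of_forall fun u => sq_nonneg _)
            (((integrable_const _).add hD).mul_const _) (Filter.Eventually.of_forall hpt)
      _ = (K / 2 + ∫ v, D v) * ‖X‖ ^ 2 := by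
          rw [integral_mul_const, integral_add (integrable_const _) hD]
          simp
      _ ≤ (K / 2 + K / 2) * ‖X‖ ^ 2 := by gcongr
      _ = K * ‖X‖ ^ 2 := by ring
  have h5 := Real.sqrt_le_sqrt hsq
  rwa [Real.sqrt_sq (norm_nonneg _), Real.sqrt_mul' _ (sq_nonneg _),
    Real.sqrt_sq (norm_nonneg _)] at h5

/-- The shift of an induced graphon has finite rank. -/
theorem finiteDimensional_range_shift_induced (W : Graphon) (n : ℕ) [NeZero n] :
    FiniteDimensional ℝ
      (LinearMap.range ((W.induced n).shift : SignalSpace →ₗ[ℝ] SignalSpace)) := by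
  have hm : ∀ a : Fin n → ℝ, MemLp (fun v => a (cell n v)) 2 (volume : Measure I) := fun a =>
    MemLp.of_bound
      ((measurable_of_countable a).comp (measurable_cell n)).aestronglyMeasurable
      (∑ i, ‖a i‖) (Filter.Eventually.of_forall fun u =>
        Finset.single_le_sum (f := fun i => ‖a i‖) (fun i _ => norm_nonneg _)
          (Finset.mem_univ (cell n u)))
  let L : (Fin n → ℝ) →ₗ[ℝ] SignalSpace :=
    { toFun := fun a => (hm a).toLp _
      map_add' := fun a b => rfl
      map_smul' := fun r a => rfl }
  have h : LinearMap.range ((W.induced n).shift : SignalSpace →ₗ[ℝ] SignalSpace) ≤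
      LinearMap.range L := by
    rintro _ ⟨X, rfl⟩
    -- The image is a step function: its value at `v` depends only on `cell n v`.
    exact ⟨fun j => ∫ u, W.graphMatrix n (cell n u) j * X u, rfl⟩
  exact Submodule.finiteDimensional_of_le h

end Graphon

/-! ### Sampling errors on the partition into cells -/

/-- The distance from `u` to the sampling point of its cell. -/
noncomputable def cellOffset (n : ℕ) [NeZero n] (u : I) : ℝ := u - samplePoint n (cell n u)

section Sampling

variable (n : ℕ) [NeZero n]

theorem measurable_cellOffset : Measurable (cellOffset n) :=
  measurable_subtype_coe.sub
    ((measurable_of_countable fun i => (samplePoint n i : ℝ)).comp (measurable_cell n))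

theorem cellOffset_eq (u : I) :
    cellOffset n u = u - (min ⌊(n : ℝ) * u⌋₊ (n - 1) : ℕ) / (n : ℝ) := rfl

theorem cellOffset_nonneg (u : I) : 0 ≤ cellOffset n u := by
  have hn : (0 : ℝ) < n := by exact_mod_cast NeZero.pos n
  rw [cellOffset_eq, sub_nonneg, div_le_iff₀ hn]
  have h1 : ((min ⌊(n : ℝ) * u⌋₊ (n - 1) : ℕ) : ℝ) ≤ (⌊(n : ℝ) * u⌋₊ : ℝ) := by
    exact_mod_cast min_le_left _ _
  have h2 := Nat.floor_le (mul_nonneg hn.le u.2.1)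
  linarith

theorem lt_min_floor_add_one (u : I) :
    (n : ℝ) * u ≤ (min ⌊(n : ℝ) * u⌋₊ (n - 1) : ℕ) + 1 := by
  have hn : 0 < n := NeZero.pos n
  rcases le_total ⌊(n : ℝ) * u⌋₊ (n - 1) with h | h
  · rw [min_eq_left h]
    exact (Nat.lt_floor_add_one _).le
  · rw [min_eq_right h]
    have : ((n - 1 : ℕ) : ℝ) + 1 = n := by
      rw [Nat.cast_sub hn, Nat.cast_one, sub_add_cancel]
    rw [this]
    exact mul_le_of_le_one_right (Nat.cast_nonneg _) u.2.2

theorem cellOffset_le (u : I) : cellOffset n u ≤ 1 / n := by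
  have hn : (0 : ℝ) < n := by exact_mod_cast NeZero.pos n
  have := lt_min_floor_add_one n u
  rw [cellOffset_eq, sub_le_iff_le_add, ← add_div, le_div_iff₀ hn]
  linarith

/-- Reflection roughly exchanges the distances to the two ends of a cell. As it preserves the
measure, the mean offset follows without integrating cell by cell. -/
theorem cellOffset_add_symm_le (u : I) : cellOffset n u + cellOffset n (σ u) ≤ 1 / n := by
  have hn : (0 : ℝ) < n := by exact_mod_cast NeZero.pos n
  have hn' : 0 < n := NeZero.pos n
  have key : (n : ℝ) ≤ (min ⌊(n : ℝ) * u⌋₊ (n - 1) : ℕ) +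
      (min ⌊(n : ℝ) * (σ u : I)⌋₊ (n - 1) : ℕ) + 1 := by
    have h1 := lt_min_floor_add_one n u
    have h2 := lt_min_floor_add_one n (σ u)
    set a := min ⌊(n : ℝ) * u⌋₊ (n - 1) with ha
    set b := min ⌊(n : ℝ) * (σ u : I)⌋₊ (n - 1) with hb
    by_contra! hlt
    have h3 : a + b + 2 ≤ n := by
      have : a + b + 1 < n := by exact_mod_cast hlt
      omega
    have h4 : ((a + b + 2 : ℕ) : ℝ) ≤ n := by exact_mod_cast h3
    push_cast at h4
    rw [unitInterval.coe_symm_eq] at h2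
    -- If `a + b + 2 ≤ n`, both upper bounds `h1`, `h2` must be equalities; then the floor is `a +
    -- 1`, so the minimum `a` must be `n - 1`, which is too large.
    have h5 : (n : ℝ) * u = a + 1 := by nlinarith
    have h6 : ⌊(n : ℝ) * u⌋₊ = a + 1 := by
      rw [h5]
      exact_mod_cast Nat.floor_natCast (R := ℝ) (a + 1)
    rw [h6] at ha
    omega
  rw [cellOffset_eq, cellOffset_eq, unitInterval.coe_symm_eq] at *
  have h7 : (1 : ℝ) - 1 / n ≤ ((min ⌊(n : ℝ) * u⌋₊ (n - 1) : ℕ) : ℝ) / n +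
      ((min ⌊(n : ℝ) * (1 - u)⌋₊ (n - 1) : ℕ) : ℝ) / n := by
    rw [← add_div, sub_le_iff_le_add, ← add_div, one_le_div hn]
    exact key
  linarith

theorem integrable_cellOffset : Integrable (cellOffset n) volume :=
  (memLp_top_of_bound (measurable_cellOffset n).aestronglyMeasurable (1 / n)
    (Filter.Eventually.of_forall fun u => by
      rw [Real.norm_eq_abs, abs_of_nonneg (cellOffset_nonneg n u)]
      exact cellOffset_le n u)).integrable le_top

theorem integral_cellOffset_le : ∫ u, cellOffset n u ≤ 1 / n / 2 := by
  have h1 : ∫ u, cellOffset n (σ u) = ∫ u, cellOffset n u :=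
    unitInterval.measurePreserving_symm.integral_comp
      unitInterval.symmMeasurableEquiv.measurableEmbedding _
  have h2 : Integrable (fun u => cellOffset n (σ u)) volume :=
    unitInterval.measurePreserving_symm.integrable_comp_of_integrable (integrable_cellOffset n)
  have h3 : ∫ u, (cellOffset n u + cellOffset n (σ u)) ≤ ∫ _u : I, (1 / n : ℝ) :=
    integral_mono ((integrable_cellOffset n).add h2) (integrable_const _)
      (cellOffset_add_symm_le n)
  rw [integral_add (integrable_cellOffset n) h2, h1] at h3
  simp only [integral_const, probReal_univ, one_smul] at h3
  linarith

theorem Graphon.norm_shift_sub_induced_le (W : Graphon) {A : ℝ}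
    (hW : ∀ u₁ v₁ u₂ v₂ : I,
      |W.toFun u₂ v₂ - W.toFun u₁ v₁| ≤ A * (|(u₂ : ℝ) - u₁| + |(v₂ : ℝ) - v₁|)) :
    ‖W.shift - (W.induced n).shift‖ ≤ √(A * (1 / n)) := by
  have hA : 0 ≤ A := by
    have := (abs_nonneg _).trans (hW 0 0 1 0)
    simpa using this
  refine W.norm_shift_sub_le (W.induced n) (fun u => A * cellOffset n u)
    ((integrable_cellOffset n).const_mul A) _ ?_ fun u v => ?_
  · rw [integral_const_mul, mul_div_assoc]
    exact mul_le_mul_of_nonneg_left (integral_cellOffset_le n) hA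
  · have h1 := hW (samplePoint n (cell n u)) (samplePoint n (cell n v)) u v
    have h2 : |(u : ℝ) - samplePoint n (cell n u)| = cellOffset n u :=
      abs_of_nonneg (cellOffset_nonneg n u)
    have h3 : |(v : ℝ) - samplePoint n (cell n v)| = cellOffset n v :=
      abs_of_nonneg (cellOffset_nonneg n v)
    rw [h2, h3, mul_add] at h1
    refine le_trans ?_ h1
    change (W.toFun u v - W.toFun (samplePoint n (cell n u)) (samplePoint n (cell n v))) ^ 2 ≤ _
    have h4 := W.mem_Icc' u v
    have h5 := W.mem_Icc' (samplePoint n (cell n u)) (samplePoint n (cell n v))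
    -- The difference of two values in `[0,1]` has absolute value at most `1`, so its square is at
    -- most its absolute value. This costs a square root in the rate but makes the bound additive in
    -- `u` and `v`.
    rw [← sq_abs, pow_two]
    refine mul_le_of_le_one_left (abs_nonneg _) (abs_le.2 ⟨?_, ?_⟩) <;>
      linarith [h4.1, h4.2, h5.1, h5.2]

theorem Graphon.isFiniteRankLimit_shift_induced (W : Graphon) :
    IsFiniteRankLimit (W.induced n).shift := fun ε hε =>
  ⟨(W.induced n).shift, W.finiteDimensional_range_shift_induced n, by rwa [sub_self, norm_zero]⟩

theorem norm_toLp_sub_inducedSignal_le {X : I → ℝ} (hX : MemLp X 2 (volume : Measure I)) {A : ℝ}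
    (hL : ∀ u v : I, |X u - X v| ≤ A * |(u : ℝ) - v|) :
    ‖hX.toLp X - (memLp_inducedSignal X n).toLp (inducedSignal X n)‖ ≤ A * (1 / n) := by
  have hA : 0 ≤ A := by
    have := (abs_nonneg _).trans (hL 1 0)
    simpa using this
  rw [← MemLp.toLp_sub]
  refine (Lp.norm_le_of_ae_bound (C := A * (1 / n)) (by positivity) ?_).trans ?_
  · filter_upwards [(hX.sub (memLp_inducedSignal X n)).coeFn_toLp] with u hu
    rw [hu]
    refine (hL u (samplePoint n (cell n u))).trans ?_
    have h2 : |(u : ℝ) - samplePoint n (cell n u)| = cellOffset n u :=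
      abs_of_nonneg (cellOffset_nonneg n u)
    rw [h2]
    exact mul_le_mul_of_nonneg_left (cellOffset_le n u) hA
  · simp [measureUnivNNReal]

end Sampling

/-- The induced graphons of finer and finer partitions are themselves the finite-rank approximants.
-/
theorem Graphon.isFiniteRankLimit_shift (W : Graphon) {A : ℝ}
    (hW : ∀ u₁ v₁ u₂ v₂ : I,
      |W.toFun u₂ v₂ - W.toFun u₁ v₁| ≤ A * (|(u₂ : ℝ) - u₁| + |(v₂ : ℝ) - v₁|)) :
    IsFiniteRankLimit W.shift := by
  intro ε hε
  have h1 : Filter.Tendsto (fun n : ℕ => √(A * (1 / ((n : ℝ) + 1)))) Filter.atTop (nhds 0) := by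
    have := ((tendsto_one_div_add_atTop_nhds_zero_nat (𝕜 := ℝ)).const_mul A).sqrt
    simpa using this
  obtain ⟨n, hn⟩ := (h1.eventually_lt_const hε).exists
  refine ⟨(W.induced (n + 1)).shift, W.finiteDimensional_range_shift_induced (n + 1),
    (W.norm_shift_sub_induced_le (n + 1) hW).trans_lt ?_⟩
  exact_mod_cast hn

/-! ### Matching the eigenvalues of two graphons -/

/-- Two nonincreasing nonnegative sequences that are close relative to the gaps between them: the
terms of the one are separated from the other terms of the other. -/
theorem gap_of_antitone {p q : ℕ → ℝ} {c E δ : ℝ}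
    (hp : ∀ j k, 1 ≤ j → j ≤ k → p k ≤ p j) (hq : ∀ j k, 1 ≤ j → j ≤ k → q k ≤ q j)
    (hp0 : ∀ k, 0 ≤ p k) (hq0 : ∀ k, 0 ≤ q k) (hE : ∀ k, 1 ≤ k → |p k - q k| ≤ E)
    (hEδ : E < δ) (h₁ : ∀ k, 1 ≤ k → c ≤ q k → δ ≤ |p k - q (k + 1)|)
    (h₂ : ∀ k, 1 ≤ k → c ≤ q k → δ ≤ |p (k + 1) - q k|) {k : ℕ} (hk : 1 ≤ k) (hck : c ≤ q k) :
    δ ≤ q k ∧ δ ≤ p k ∧ ∀ j, 1 ≤ j → j ≠ k → δ ≤ |p j - q k| ∧ δ ≤ |p k - q j| := by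
  -- The absolute values open with the expected sign: the opposite one would force `δ ≤ E`, by
  -- monotonicity and `hE`.
  have up : ∀ k, 1 ≤ k → c ≤ q k → δ ≤ p k - q (k + 1) ∧ δ ≤ q k - p (k + 1) := by
    intro k hk hck
    have e := abs_le.1 (hE k hk)
    have m1 := hp k (k + 1) hk (by omega)
    have m2 := hq k (k + 1) hk (by omega)
    constructor
    · rcases le_abs.1 (h₁ k hk hck) with h | h <;> linarith
    · rcases le_abs.1 (h₂ k hk hck) with h | h <;> linarith
  obtain ⟨u1, u2⟩ := up k hk hck
  refine ⟨by linarith [hp0 (k + 1)], by linarith [hq0 (k + 1)], fun j hj hjk => ?_⟩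
  rcases lt_or_gt_of_ne hjk with h | h
  -- For `j < k` the gap comes from the index `k - 1`, which meets the threshold `c` because `q` is
  -- nonincreasing.
  · obtain ⟨i, rfl⟩ : ∃ i, k = i + 1 := ⟨k - 1, by omega⟩
    have hi : 1 ≤ i := by omega
    obtain ⟨w1, w2⟩ := up i hi (hck.trans (hq i (i + 1) hi (by omega)))
    have m1 := hp j i hj (by omega)
    have m2 := hq j i hj (by omega)
    constructor
    · exact le_trans (by linarith) (le_abs_self _)
    · exact le_trans (by linarith) (neg_le_abs _)
  · have m1 := hp (k + 1) j (by omega) (by omega)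
    have m2 := hq (k + 1) j (by omega) (by omega)
    constructor
    · exact le_trans (by linarith) (neg_le_abs _)
    · exact le_trans (by linarith) (le_abs_self _)

namespace Graphon

theorem eigenvalue_natCast (W : Graphon) {k : ℕ} (hk : 1 ≤ k) :
    W.eigenvalue k = posEigenvalue W.shift k := by
  rw [eigenvalue, if_pos (by exact_mod_cast hk), Int.natAbs_natCast]

theorem eigenvalue_neg_natCast (W : Graphon) (k : ℕ) :
    W.eigenvalue (-(k : ℤ)) = -posEigenvalue (-W.shift) k := by
  rw [eigenvalue, if_neg (by omega), Int.natAbs_neg, Int.natAbs_natCast]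

theorem exists_natCast_eq {i : ℤ} (hi : i ≠ 0) :
    ∃ k : ℕ, 1 ≤ k ∧ (i = k ∨ i = -(k : ℤ)) :=
  ⟨i.natAbs, by omega, by omega⟩

theorem neg_shift_isSymmetric (W : Graphon) :
    ((-W.shift : SignalSpace →L[ℝ] SignalSpace) : SignalSpace →ₗ[ℝ] SignalSpace).IsSymmetric := by
  intro x y
  have h := W.shift_isSymmetric x y
  change inner ℝ (W.shift x) y = inner ℝ x (W.shift y) at h
  change inner ℝ (-W.shift x) y = inner ℝ x (-W.shift y)
  rw [inner_neg_left, inner_neg_right, h]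

theorem abs_eigenvalue_sub_le {W W' : Graphon} (hW : IsFiniteRankLimit W.shift)
    (hW' : IsFiniteRankLimit W'.shift) {i : ℤ} (hi : i ≠ 0) :
    |W.eigenvalue i - W'.eigenvalue i| ≤ ‖W.shift - W'.shift‖ := by
  obtain ⟨k, hk, rfl | rfl⟩ := exists_natCast_eq hi
  · rw [eigenvalue_natCast _ hk, eigenvalue_natCast _ hk]
    exact abs_posEigenvalue_sub_le W.shift_isSymmetric hW W'.shift_isSymmetric hW' hk
  · rw [eigenvalue_neg_natCast, eigenvalue_neg_natCast, neg_sub_neg, abs_sub_comm]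
    have h := abs_posEigenvalue_sub_le W.neg_shift_isSymmetric hW.neg
      W'.neg_shift_isSymmetric hW'.neg hk
    rwa [neg_sub_neg, norm_sub_rev] at h

/-- Negative eigenvalues are the positive ones of `-W.shift`. The eigenvalue `0` may be missing from
the list, and is treated separately wherever this is used. -/
theorem exists_eigenvalue_eq {W : Graphon} (hW : IsFiniteRankLimit W.shift) {μ : ℝ}
    (hμ : μ ≠ 0) (hne : eigSpace W.shift μ ≠ ⊥) : ∃ i : ℤ, i ≠ 0 ∧ W.eigenvalue i = μ := by
  rcases lt_or_gt_of_ne hμ with h | h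
  · have h1 : eigSpace (-W.shift) (-μ) = eigSpace W.shift μ := by
      ext x
      rw [mem_eigSpace, mem_eigSpace, neg_apply, neg_smul, neg_inj]
    obtain ⟨k, hk, hkμ⟩ := exists_posEigenvalue_eq W.neg_shift_isSymmetric hW.neg
      (neg_pos.2 h) (h1 ▸ hne)
    exact ⟨-(k : ℤ), by omega, by rw [eigenvalue_neg_natCast, hkμ, neg_neg]⟩
  · obtain ⟨k, hk, hkμ⟩ := exists_posEigenvalue_eq W.shift_isSymmetric hW h hne
    exact ⟨k, by omega, by rw [eigenvalue_natCast _ hk, hkμ]⟩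

theorem finite_band {W : Graphon} (hW : IsFiniteRankLimit W.shift) {c : ℝ} (hc : 0 < c) :
    (W.band c).Finite := by
  obtain ⟨N, hN⟩ := exists_le_of_le_posEigenvalue W.shift_isSymmetric hW hc
  obtain ⟨M, hM⟩ := exists_le_of_le_posEigenvalue W.neg_shift_isSymmetric hW.neg hc
  refine (Set.finite_Icc (-(M : ℤ)) N).subset ?_
  rintro i ⟨hi, hci⟩
  obtain ⟨k, hk, rfl | rfl⟩ := exists_natCast_eq hi
  · rw [eigenvalue_natCast _ hk, abs_of_nonneg (posEigenvalue_nonneg _)] at hci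
    have := hN k hci
    constructor <;> omega
  · rw [eigenvalue_neg_natCast, abs_neg, abs_of_nonneg (posEigenvalue_nonneg _)] at hci
    have := hM k hci
    constructor <;> omega

theorem eigengap_le {W W' : Graphon} {c d : ℝ} {i : ℤ} (hi : i ∈ W'.band c)
    (hd : d = |W.eigenvalue i - W'.eigenvalue (i + i.sign)| ∨
      d = |W.eigenvalue (i + i.sign) - W'.eigenvalue i|) : W.eigengap W' c ≤ d := by
  refine csInf_le ⟨0, ?_⟩ ⟨i, hi, hd.elim Or.inl fun h => Or.inr (Or.inl h)⟩
  rintro _ ⟨_, _, rfl | rfl | rfl | rfl⟩ <;> exact abs_nonneg _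

/-- If the shift operators are closer than the eigengap, the eigenvalues of either graphon with
index in the band are separated from the eigenvalues with other indices of the other one. -/
theorem eigenvalue_separated {W W' : Graphon} (hW : IsFiniteRankLimit W.shift)
    (hW' : IsFiniteRankLimit W'.shift) {c : ℝ}
    (hgap : ‖W.shift - W'.shift‖ < W.eigengap W' c) {i : ℤ} (hi : i ∈ W'.band c) :
    W.eigengap W' c ≤ |W'.eigenvalue i| ∧ W.eigengap W' c ≤ |W.eigenvalue i| ∧
      ∀ j : ℤ, j ≠ 0 → j ≠ i →
        W.eigengap W' c ≤ |W.eigenvalue j - W'.eigenvalue i| ∧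
        W.eigengap W' c ≤ |W.eigenvalue i - W'.eigenvalue j| := by
  have hpos := fun (k : ℕ) (hk : 1 ≤ k) (hck : c ≤ posEigenvalue W'.shift k) =>
    gap_of_antitone (p := posEigenvalue W.shift) (q := posEigenvalue W'.shift)
      (fun _ _ => posEigenvalue_anti) (fun _ _ => posEigenvalue_anti)
      posEigenvalue_nonneg posEigenvalue_nonneg
      (fun k hk => abs_posEigenvalue_sub_le W.shift_isSymmetric hW W'.shift_isSymmetric hW' hk)
      hgap
      (fun k hk hck => by
        refine eigengap_le (i := k) ⟨by omega, ?_⟩ (Or.inl ?_)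
        · rwa [eigenvalue_natCast _ hk, abs_of_nonneg (posEigenvalue_nonneg _)]
        · rw [Int.sign_natCast_of_ne_zero (by omega), ← Nat.cast_succ,
            eigenvalue_natCast _ hk, eigenvalue_natCast _ (by omega)])
      (fun k hk hck => by
        refine eigengap_le (i := k) ⟨by omega, ?_⟩ (Or.inr ?_)
        · rwa [eigenvalue_natCast _ hk, abs_of_nonneg (posEigenvalue_nonneg _)]
        · rw [Int.sign_natCast_of_ne_zero (by omega), ← Nat.cast_succ,
            eigenvalue_natCast _ hk, eigenvalue_natCast _ (by omega)])
      hk hck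
  have hsucc : ∀ k : ℕ, 1 ≤ k → -(k : ℤ) + (-(k : ℤ)).sign = -((k + 1 : ℕ) : ℤ) := fun k hk => by
    rw [Int.sign_neg, Int.sign_natCast_of_ne_zero (by omega)]
    push_cast
    ring
  have hneg := fun (k : ℕ) (hk : 1 ≤ k) (hck : c ≤ posEigenvalue (-W'.shift) k) =>
    gap_of_antitone (p := posEigenvalue (-W.shift)) (q := posEigenvalue (-W'.shift))
      (fun _ _ => posEigenvalue_anti) (fun _ _ => posEigenvalue_anti)
      posEigenvalue_nonneg posEigenvalue_nonneg
      (fun k hk => abs_posEigenvalue_sub_le W.neg_shift_isSymmetric hW.neg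
        W'.neg_shift_isSymmetric hW'.neg hk)
      (by rwa [neg_sub_neg, norm_sub_rev])
      (fun k hk hck => by
        refine eigengap_le (i := -(k : ℤ)) ⟨by omega, ?_⟩ (Or.inl ?_)
        · rwa [eigenvalue_neg_natCast, abs_neg, abs_of_nonneg (posEigenvalue_nonneg _)]
        · rw [hsucc k hk, eigenvalue_neg_natCast, eigenvalue_neg_natCast, neg_sub_neg,
            abs_sub_comm])
      (fun k hk hck => by
        refine eigengap_le (i := -(k : ℤ)) ⟨by omega, ?_⟩ (Or.inr ?_)
        · rwa [eigenvalue_neg_natCast, abs_neg, abs_of_nonneg (posEigenvalue_nonneg _)]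
        · rw [hsucc k hk, eigenvalue_neg_natCast, eigenvalue_neg_natCast, neg_sub_neg,
            abs_sub_comm])
      hk hck
  obtain ⟨hi0, hci⟩ := hi
  obtain ⟨k, hk, rfl | rfl⟩ := exists_natCast_eq hi0
  · rw [eigenvalue_natCast _ hk] at hci ⊢
    rw [eigenvalue_natCast _ hk]
    rw [abs_of_nonneg (posEigenvalue_nonneg _)] at hci ⊢
    rw [abs_of_nonneg (posEigenvalue_nonneg _)]
    obtain ⟨h1, h2, h3⟩ := hpos k hk hci
    refine ⟨h1, h2, fun j hj0 hjk => ?_⟩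
    obtain ⟨m, hm, rfl | rfl⟩ := exists_natCast_eq hj0
    · rw [eigenvalue_natCast _ hm, eigenvalue_natCast _ hm]
      exact h3 m hm fun h => hjk (by rw [h])
    -- Eigenvalues of opposite sign lie on the other side of `0`, from which the band eigenvalues
    -- already keep distance `δ`.
    · rw [eigenvalue_neg_natCast, eigenvalue_neg_natCast]
      have n1 := posEigenvalue_nonneg (T := -W.shift) m
      have n2 := posEigenvalue_nonneg (T := -W'.shift) m
      exact ⟨le_trans (by linarith) (neg_le_abs _), le_trans (by linarith) (le_abs_self _)⟩
  · rw [eigenvalue_neg_natCast, abs_neg] at hci ⊢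
    rw [eigenvalue_neg_natCast, abs_neg]
    rw [abs_of_nonneg (posEigenvalue_nonneg _)] at hci ⊢
    rw [abs_of_nonneg (posEigenvalue_nonneg _)]
    obtain ⟨h1, h2, h3⟩ := hneg k hk hci
    refine ⟨h1, h2, fun j hj0 hjk => ?_⟩
    obtain ⟨m, hm, rfl | rfl⟩ := exists_natCast_eq hj0
    · rw [eigenvalue_natCast _ hm, eigenvalue_natCast _ hm]
      have n1 := posEigenvalue_nonneg (T := W.shift) m
      have n2 := posEigenvalue_nonneg (T := W'.shift) m
      exact ⟨le_trans (by linarith) (le_abs_self _), le_trans (by linarith) (neg_le_abs _)⟩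
    · rw [eigenvalue_neg_natCast, eigenvalue_neg_natCast, neg_sub_neg, neg_sub_neg,
        abs_sub_comm, abs_sub_comm (posEigenvalue (-W'.shift) m)]
      exact h3 m hm fun h => hjk (by rw [h])

end Graphon

/-! ### Stability of spectral convolutions -/

/-- A Davis–Kahan type bound for the projections onto separated eigenspaces. -/
theorem norm_eigProj_sub_eigProj_le {T T' : SignalSpace →L[ℝ] SignalSpace}
    (hs : (T : SignalSpace →ₗ[ℝ] SignalSpace).IsSymmetric) (hc : IsCompactOperator T)
    (hs' : (T' : SignalSpace →ₗ[ℝ] SignalSpace).IsSymmetric) (hc' : IsCompactOperator T')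
    {a b δ : ℝ} (hδ : 0 < δ) (hsep : ∀ μ, eigSpace T μ ≠ ⊥ → μ ≠ a → δ ≤ |μ - b|)
    (hsep' : ∀ μ, eigSpace T' μ ≠ ⊥ → μ ≠ b → δ ≤ |μ - a|) (x : SignalSpace) :
    ‖(eigSpace T a).starProjection x - (eigSpace T' b).starProjection x‖ ≤
      ‖T - T'‖ / δ * ‖x‖ := by
  refine norm_starProjection_sub_le _ _ (by positivity) (fun y hy => ?_) (fun y hy => ?_) x
  -- For `T y = a • y` the residual `T' y - a • y` is `(T' - T) y`. This is why each separation
  -- compares the spectrum of one operator with the eigenvalue of the other.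
  · have h1 := norm_sub_eigProj_le hs' hc' hδ hsep' y
    rw [← mem_eigSpace.1 hy, norm_sub_rev (T' y), ← sub_apply] at h1
    rw [div_mul_eq_mul_div, le_div_iff₀' hδ]
    exact h1.trans ((T - T').le_opNorm y)
  · have h1 := norm_sub_eigProj_le hs hc hδ hsep y
    rw [← mem_eigSpace.1 hy, ← sub_apply] at h1
    rw [div_mul_eq_mul_div, le_div_iff₀' hδ]
    exact h1.trans ((T - T').le_opNorm y)

namespace Graphon

theorem mem_Icc_of_eigSpace_ne_bot (W : Graphon) {μ : ℝ} (h : eigSpace W.shift μ ≠ ⊥) :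
    μ ∈ Set.Icc (-1 : ℝ) 1 :=
  abs_le.1 ((abs_le_norm_of_eigSpace_ne_bot h).trans W.norm_shift_le_one)

theorem eigenvalue_mem_Icc (W : Graphon) {i : ℤ} (hi : i ≠ 0) :
    W.eigenvalue i ∈ Set.Icc (-1 : ℝ) 1 := by
  have hle : ∀ T : SignalSpace →L[ℝ] SignalSpace, ∀ k : ℕ, 1 ≤ k → ‖T‖ ≤ 1 →
      posEigenvalue T k ≤ 1 := fun T k hk hT =>
    Real.sSup_le (fun t ht => (le_norm_of_mem_eigLevels hk ht).trans hT) zero_le_one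
  obtain ⟨k, hk, rfl | rfl⟩ := exists_natCast_eq hi
  · rw [eigenvalue_natCast _ hk]
    exact ⟨by linarith [posEigenvalue_nonneg (T := W.shift) k], hle _ k hk W.norm_shift_le_one⟩
  · rw [eigenvalue_neg_natCast]
    have := hle (-W.shift) k hk (by rw [norm_neg]; exact W.norm_shift_le_one)
    exact ⟨by linarith, by linarith [posEigenvalue_nonneg (T := -W.shift) k]⟩

variable {W W' : Graphon} {h : ℝ → ℝ} {A c : ℝ}

theorem norm_specConv_shift_le (hW : IsFiniteRankLimit W.shift)
    (hlt : ∀ x ∈ Set.Icc (-1 : ℝ) 1, |h x| < 1) (x : SignalSpace) :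
    ‖specConv h W.shift x‖ ≤ ‖x‖ := by
  have := norm_specConv_le W.shift_isSymmetric hW.isCompactOperator zero_le_one
    (fun μ hμ => (hlt μ (W.mem_Icc_of_eigSpace_ne_bot hμ)).le) x
  rwa [one_mul] at this

/-- The case where the perturbation is smaller than the gap. If the band is empty, the sum over it
vanishes and only the Lipschitz term remains. -/
theorem norm_specConv_sub_le_of_separated (hW : IsFiniteRankLimit W.shift)
    (hW' : IsFiniteRankLimit W'.shift) (hc : 0 < c)
    (hconst : ∀ x ∈ Set.Icc (-1 : ℝ) 1, ∀ y ∈ Set.Icc (-1 : ℝ) 1, |x| < c → |y| < c → h x = h y)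
    (hLip : ∀ x ∈ Set.Icc (-1 : ℝ) 1, ∀ y ∈ Set.Icc (-1 : ℝ) 1, |h x - h y| ≤ A * |x - y|)
    (hlt : ∀ x ∈ Set.Icc (-1 : ℝ) 1, |h x| < 1)
    (hgap : (W'.band c).Nonempty → ‖W.shift - W'.shift‖ < W.eigengap W' c) (x : SignalSpace) :
    ‖specConv h W.shift x - specConv h W'.shift x‖ ≤
      ‖W.shift - W'.shift‖ * (A + 2 * W'.bandCard c / W.eigengap W' c) * ‖x‖ := by
  set E := ‖W.shift - W'.shift‖ with hE
  set δ := W.eigengap W' c with hδ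
  have hE0 : 0 ≤ E := norm_nonneg _
  have hA : 0 ≤ A := by
    have := (abs_nonneg _).trans (hLip 0 (by norm_num) 1 (by norm_num))
    simpa using this
  have h0 : (0 : ℝ) ∈ Set.Icc (-1 : ℝ) 1 := by norm_num
  have hfin := finite_band hW' hc
  set S := hfin.toFinset with hS
  have hmem : ∀ i, i ∈ S ↔ i ∈ W'.band c := fun i => hfin.mem_toFinset
  have hEδ : ∀ i ∈ S, E < δ := fun i hi => hgap ⟨i, (hmem i).1 hi⟩
  have hsep := fun i (hi : i ∈ S) => eigenvalue_separated hW hW' (hEδ i hi) ((hmem i).1 hi)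
  have hne0 : ∀ i ∈ S, i ≠ 0 := fun i hi => ((hmem i).1 hi).1
  have hweyl := fun (i : ℤ) (hi : i ≠ 0) => abs_eigenvalue_sub_le hW hW' hi
  -- Separation excludes coincidences with band eigenvalues, so a sum of indicators evaluated at the
  -- `j`-th eigenvalue keeps at most the `j`-th term.
  have hsum : ∀ (a : ℤ → ℝ) (β : ℤ → ℝ) (j : ℤ), (∀ i ∈ S, i ≠ j → a j ≠ a i) →
      (∑ i ∈ S, if a j = a i then β i else 0) = if j ∈ S then β j else 0 := by
    intro a β j hinj
    rw [← Finset.sum_ite_eq S j β]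
    refine Finset.sum_congr rfl fun i hi => ?_
    by_cases hij : j = i
    · simp [hij]
    · rw [if_neg (hinj i hi (Ne.symm hij)), if_neg hij]
  have hsum0 : ∀ (a : ℤ → ℝ) (β : ℤ → ℝ), (∀ i ∈ S, a i ≠ 0) →
      (∑ i ∈ S, if 0 = a i then β i else 0) = 0 := fun a β hne =>
    Finset.sum_eq_zero fun i hi => if_neg (hne i hi).symm
  set β : ℤ → ℝ := fun i => h (W'.eigenvalue i) - h 0 with hβ
  have hβval : ∀ j : ℤ, j ≠ 0 → h 0 + (if j ∈ S then β j else 0) = h (W'.eigenvalue j) := by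
    intro j hj
    by_cases hjS : j ∈ S
    · rw [if_pos hjS, hβ]
      ring
    · rw [if_neg hjS, add_zero]
      have hjc : |W'.eigenvalue j| < c := by
        by_contra! hcon
        exact hjS ((hmem j).2 ⟨hj, hcon⟩)
      exact hconst 0 h0 _ (W'.eigenvalue_mem_Icc hj) (by rwa [abs_zero]) hjc
  set g : ℝ → ℝ := fun μ => h 0 + ∑ i ∈ S, if μ = W.eigenvalue i then β i else 0 with hg
  set g' : ℝ → ℝ := fun μ => h 0 + ∑ i ∈ S, if μ = W'.eigenvalue i then β i else 0 with hg'
  have hg'h : ∀ μ, eigSpace W'.shift μ ≠ ⊥ → h μ = g' μ := by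
    intro μ hμ
    by_cases hμ0 : μ = 0
    · subst hμ0
      rw [hg']
      beta_reduce
      rw [hsum0 _ _ fun i hi hz => ?_, add_zero]
      have := (hsep i hi).1
      rw [hz, abs_zero] at this
      linarith [hEδ i hi]
    · obtain ⟨j, hj, rfl⟩ := exists_eigenvalue_eq hW' hμ0 hμ
      rw [hg']
      beta_reduce
      rw [hsum W'.eigenvalue β j fun i hi hij heq => ?_, hβval j hj]
      have h1 := (((hsep i hi).2.2 j hj hij.symm).2)
      rw [heq] at h1
      linarith [hweyl i (hne0 i hi), hEδ i hi]
  -- At `λ_j` of `W` the function `g` takes the value of `h` at the `j`-th eigenvalue of `W'`, so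
  -- Weyl and the Lipschitz bound apply.
  have hgh : ∀ μ, eigSpace W.shift μ ≠ ⊥ → |h μ - g μ| ≤ A * E := by
    intro μ hμ
    by_cases hμ0 : μ = 0
    · subst hμ0
      rw [hg]
      beta_reduce
      rw [hsum0 _ _ fun i hi hz => ?_, add_zero, sub_self, abs_zero]
      · positivity
      have := (hsep i hi).2.1
      rw [hz, abs_zero] at this
      linarith [hEδ i hi]
    · obtain ⟨j, hj, rfl⟩ := exists_eigenvalue_eq hW hμ0 hμ
      rw [hg]
      beta_reduce
      rw [hsum W.eigenvalue β j fun i hi hij heq => ?_, hβval j hj]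
      · refine (hLip _ (W.eigenvalue_mem_Icc hj) _ (W'.eigenvalue_mem_Icc hj)).trans ?_
        exact mul_le_mul_of_nonneg_left (hweyl j hj) hA
      have h1 := (((hsep i hi).2.2 j hj hij.symm).1)
      rw [heq] at h1
      linarith [hweyl i (hne0 i hi), hEδ i hi]
  have hhB : ∀ μ, eigSpace W.shift μ ≠ ⊥ → |h μ| ≤ 1 := fun μ hμ =>
    (hlt μ (W.mem_Icc_of_eigSpace_ne_bot hμ)).le
  have hgB : ∀ μ, eigSpace W.shift μ ≠ ⊥ → |g μ| ≤ 1 + A * E := fun μ hμ => by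
    have h1 := abs_sub_abs_le_abs_sub (g μ) (h μ)
    rw [abs_sub_comm] at h1
    linarith [hgh μ hμ, hhB μ hμ]
  have e1 := specConv_sub_response W.shift_isSymmetric hW.isCompactOperator hhB hgB x
  have e2 := specConv_const_add_sum W.shift_isSymmetric hW.isCompactOperator S W.eigenvalue β
    (h 0) x
  have e3 := specConv_const_add_sum W'.shift_isSymmetric hW'.isCompactOperator S W'.eigenvalue β
    (h 0) x
  rw [← hg] at e2
  rw [← hg', ← specConv_congr hg'h] at e3
  have n1 := norm_specConv_le W.shift_isSymmetric hW.isCompactOperator (by positivity) hgh x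
  have n2 : ‖∑ i ∈ S, β i • ((eigSpace W.shift (W.eigenvalue i)).starProjection x -
      (eigSpace W'.shift (W'.eigenvalue i)).starProjection x)‖ ≤
      ∑ _i ∈ S, 2 * (E / δ * ‖x‖) := by
    refine norm_sum_le_of_le _ fun i hi => ?_
    rw [norm_smul]
    have hδ0 : 0 < δ := hE0.trans_lt (hEδ i hi)
    refine mul_le_mul ?_ ?_ (norm_nonneg _) zero_le_two
    · refine (norm_sub_le _ _).trans ?_
      rw [Real.norm_eq_abs, Real.norm_eq_abs]
      linarith [hlt 0 h0, hlt _ (W'.eigenvalue_mem_Icc (hne0 i hi))]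
    · refine norm_eigProj_sub_eigProj_le W.shift_isSymmetric hW.isCompactOperator
        W'.shift_isSymmetric hW'.isCompactOperator hδ0 (fun μ hμ hne => ?_)
        (fun μ hμ hne => ?_) x
      · by_cases hμ0 : μ = 0
        · rw [hμ0, zero_sub, abs_neg]
          exact (hsep i hi).1
        · obtain ⟨j, hj, rfl⟩ := exists_eigenvalue_eq hW hμ0 hμ
          exact ((hsep i hi).2.2 j hj fun hji => hne (by rw [hji])).1
      · by_cases hμ0 : μ = 0
        · rw [hμ0, zero_sub, abs_neg]
          exact (hsep i hi).2.1
        · obtain ⟨j, hj, rfl⟩ := exists_eigenvalue_eq hW' hμ0 hμ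
          rw [abs_sub_comm]
          exact ((hsep i hi).2.2 j hj fun hji => hne (by rw [hji])).2
  have hcard : (W'.bandCard c : ℝ) = S.card := by
    rw [bandCard, Set.ncard_eq_toFinset_card _ hfin]
  have e4 : specConv h W.shift x - specConv h W'.shift x =
      specConv (fun μ => h μ - g μ) W.shift x +
      ∑ i ∈ S, β i • ((eigSpace W.shift (W.eigenvalue i)).starProjection x -
        (eigSpace W'.shift (W'.eigenvalue i)).starProjection x) := by
    simp only [smul_sub, Finset.sum_sub_distrib]
    rw [e1, e2, e3]
    abel
  rw [e4]
  refine (norm_add_le_of_le n1 n2).trans (le_of_eq ?_)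
  rw [Finset.sum_const, nsmul_eq_mul, hcard]
  ring

/-- If `‖W.shift - W'.shift‖` reaches the gap, the band is nonempty, so the factor on the right is
at least `2`, which the bound `|h| < 1` alone already achieves. -/
theorem norm_specConv_sub_le (hW : IsFiniteRankLimit W.shift)
    (hW' : IsFiniteRankLimit W'.shift) (hc : 0 < c)
    (hconst : ∀ x ∈ Set.Icc (-1 : ℝ) 1, ∀ y ∈ Set.Icc (-1 : ℝ) 1, |x| < c → |y| < c → h x = h y)
    (hLip : ∀ x ∈ Set.Icc (-1 : ℝ) 1, ∀ y ∈ Set.Icc (-1 : ℝ) 1, |h x - h y| ≤ A * |x - y|)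
    (hlt : ∀ x ∈ Set.Icc (-1 : ℝ) 1, |h x| < 1)
    (hδ : (W'.band c).Nonempty → 0 < W.eigengap W' c) (x : SignalSpace) :
    ‖specConv h W.shift x - specConv h W'.shift x‖ ≤
      ‖W.shift - W'.shift‖ * (A + 2 * W'.bandCard c / W.eigengap W' c) * ‖x‖ := by
  by_cases hgap : (W'.band c).Nonempty → ‖W.shift - W'.shift‖ < W.eigengap W' c
  · exact norm_specConv_sub_le_of_separated hW hW' hc hconst hLip hlt hgap x
  · push Not at hgap
    obtain ⟨hne, hle⟩ := hgap
    have hδ0 := hδ hne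
    have hA : 0 ≤ A := by
      have := (abs_nonneg _).trans (hLip 0 (by norm_num) 1 (by norm_num))
      simpa using this
    have hcard : (1 : ℝ) ≤ W'.bandCard c := by
      exact_mod_cast (Set.ncard_pos (finite_band hW' hc)).2 hne
    have h1 : ‖specConv h W.shift x - specConv h W'.shift x‖ ≤ ‖x‖ + ‖x‖ :=
      norm_sub_le_of_le (norm_specConv_shift_le hW hlt x) (norm_specConv_shift_le hW' hlt x)
    have h2 : 2 ≤ ‖W.shift - W'.shift‖ * (A + 2 * W'.bandCard c / W.eigengap W' c) := by
      calc (2 : ℝ) = W.eigengap W' c * (0 + 2 * 1 / W.eigengap W' c) := by field_simp; ring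
        _ ≤ _ := by gcongr
    calc _ ≤ 2 * ‖x‖ := by linarith
      _ ≤ _ := by gcongr

end Graphon

/-! ### Convergence of sampled graphon convolutions -/

theorem theorem3 (W : Graphon) (h : ℝ → ℝ) (X : unitInterval → ℝ) (A₁ A₂ A₃ c : ℝ)
    (n : ℕ) [NeZero n]
    (hW : ∀ u₁ v₁ u₂ v₂ : unitInterval,
      |W.toFun u₂ v₂ - W.toFun u₁ v₁| ≤ A₁ * (|(u₂ : ℝ) - u₁| + |(v₂ : ℝ) - v₁|))
    (hc : 0 < c)
    (hconst : ∀ x ∈ Set.Icc (-1 : ℝ) 1, ∀ y ∈ Set.Icc (-1 : ℝ) 1, |x| < c → |y| < c → h x = h y)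
    (hLip : ∀ x ∈ Set.Icc (-1 : ℝ) 1, ∀ y ∈ Set.Icc (-1 : ℝ) 1, |h x - h y| ≤ A₂ * |x - y|)
    (hlt : ∀ x ∈ Set.Icc (-1 : ℝ) 1, |h x| < 1)
    (hX : MemLp X 2 (volume : Measure unitInterval))
    (hδ : ((W.induced n).band c).Nonempty → 0 < W.eigengap (W.induced n) c) :
    ((∀ u v : unitInterval, |X u - X v| ≤ A₃ * |(u : ℝ) - v|) →
      ‖specConv h W.shift (hX.toLp X) -
          specConv h (W.induced n).shift ((memLp_inducedSignal X n).toLp (inducedSignal X n))‖ ≤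
        √A₁ * (A₂ + Real.pi * (W.induced n).bandCard c / W.eigengap (W.induced n) c) *
            (n : ℝ) ^ (-(1 / 2) : ℝ) * ‖hX.toLp X‖ +
          2 * A₃ / √3 * (n : ℝ) ^ (-(1 / 2) : ℝ)) ∧
    (X =ᵐ[volume] inducedSignal X n →
      ‖specConv h W.shift (hX.toLp X) -
          specConv h (W.induced n).shift ((memLp_inducedSignal X n).toLp (inducedSignal X n))‖ ≤
        √A₁ * (A₂ + Real.pi * (W.induced n).bandCard c / W.eigengap (W.induced n) c) *
            (n : ℝ) ^ (-(1 / 2) : ℝ) * ‖hX.toLp X‖) := by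
  have hlim := W.isFiniteRankLimit_shift hW
  have hlim' := W.isFiniteRankLimit_shift_induced n
  have hn1 : (1 : ℝ) ≤ n := by exact_mod_cast NeZero.one_le
  have hA₁ : 0 ≤ A₁ := by
    have := (abs_nonneg _).trans (hW 0 0 1 0)
    simpa using this
  have hA₂ : 0 ≤ A₂ := by
    have := (abs_nonneg _).trans (hLip 0 (by norm_num) 1 (by norm_num))
    simpa using this
  -- Needed to enlarge `2` to `π` in the numerator. For an empty band the infimum is `sInf ∅ = 0`,
  -- and the quotient is `0 / 0 = 0`.
  have hgap0 : 0 ≤ W.eigengap (W.induced n) c := by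
    refine Real.sInf_nonneg ?_
    rintro _ ⟨_, _, rfl | rfl | rfl | rfl⟩ <;> exact abs_nonneg _
  have hpow : (n : ℝ) ^ (-(1 / 2) : ℝ) = √(1 / n) := by
    rw [Real.rpow_neg (by linarith), ← Real.sqrt_eq_rpow, one_div, Real.sqrt_inv]
  have hE := W.norm_shift_sub_induced_le n hW
  rw [Real.sqrt_mul hA₁, ← hpow] at hE
  have hmain : ‖specConv h W.shift (hX.toLp X) - specConv h (W.induced n).shift (hX.toLp X)‖ ≤
      √A₁ * (A₂ + Real.pi * (W.induced n).bandCard c / W.eigengap (W.induced n) c) *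
        (n : ℝ) ^ (-(1 / 2) : ℝ) * ‖hX.toLp X‖ := by
    refine (Graphon.norm_specConv_sub_le hlim hlim' hc hconst hLip hlt hδ (hX.toLp X)).trans ?_
    rw [mul_right_comm (√A₁)]
    gcongr
    exact Real.two_le_pi
  constructor
  · intro hL
    have hA₃ : 0 ≤ A₃ := by
      have := (abs_nonneg _).trans (hL 1 0)
      simpa using this
    have hsig := norm_toLp_sub_inducedSignal_le n hX hL
    have hsub := specConv_sub (W.induced n).shift_isSymmetric hlim'.isCompactOperator
      (fun μ hμ => (hlt μ ((W.induced n).mem_Icc_of_eigSpace_ne_bot hμ)).le) (hX.toLp X)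
      ((memLp_inducedSignal X n).toLp (inducedSignal X n))
    have hY := Graphon.norm_specConv_shift_le hlim' hlt
      (hX.toLp X - (memLp_inducedSignal X n).toLp (inducedSignal X n))
    rw [hsub] at hY
    -- The rate `1 / n` for the signal is weakened to the stated form by `1 / n ≤ √(1 / n)` and `√3
    -- ≤ 2`.
    have hroot : A₃ * (1 / n) ≤ 2 * A₃ / √3 * (n : ℝ) ^ (-(1 / 2) : ℝ) := by
      have h1 : (1 / n : ℝ) ≤ √(1 / n) := by
        refine Real.le_sqrt_of_sq_le ?_
        have h2 : (1 / n : ℝ) ≤ 1 := (div_le_one (by linarith)).2 hn1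
        have h3 : (0 : ℝ) ≤ 1 / n := by positivity
        nlinarith
      have h4 : A₃ ≤ 2 * A₃ / √3 := by
        rw [le_div_iff₀ (by positivity), mul_comm]
        gcongr
        rw [Real.sqrt_le_left (by norm_num)]
        norm_num
      rw [hpow]
      gcongr
    exact (norm_sub_le_norm_sub_add_norm_sub _
      (specConv h (W.induced n).shift (hX.toLp X)) _).trans
      (add_le_add hmain (hY.trans (hsig.trans hroot)))
  · intro hXn
    rw [← (MemLp.toLp_eq_toLp_iff hX (memLp_inducedSignal X n)).2 hXn]
    exact hmain
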